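/- Let $N$ be a natural number, $\Omega\subset\mathbb R^N$ an open set, $0<T<\infty$, and $\Omega_T=(0,T)\times\Omega$. A $\Phi$-function on an open set $O$ is a function $M:O\times[0,\infty)\to[0,\infty)$ such that $M(\cdot,s)$ is (Lebesgue) measurable for every $s\ge 0$ and, for almost every $z\in O$, $M(z,\cdot)$ is convex, $M(z,0)=0$, $M(z,s)>0$ for $s>0$, $M(z,s)\to\infty$ as $s\to\infty$, $\lim_{s\to0}M(z,s)/s=0$ and $\lim_{s\to\infty}M(z,s)/s=\infty$. The functions $M,M^*$ are complementary if both are $\Phi$-functions and $M^*(z,s)=\sup_{r\ge0}\{sr-M(z,r)\}$ for all $s\ge0$ and a.e. $z\in O$. A $\Phi$-function $M$ is locally integrable on $O$ if $\int_K M(z,c)\,dz<\infty$ for every $c>0$ and every compact $K\subset O$. $L_M(O)$ (resp. $E_M(O)$) is the set of measurable $u:O\to\mathbb R$ with $\int_O M(z,|u(z)|/\lambda)\,dz<\infty$ for some (resp. for all) $\lambda>0$. $C_0^\infty(O)$ is the set of smooth functions with compact support in $O$. $\nabla$ is the distributional gradient in the variable $x\in\mathbb R^N$ only, and a function $u$ is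 identified with the tuple $(u,\nabla u)$ in the product $\Pi L_M=L_M(O)^{N+1}$. The topology $\sigma(\Pi L_M,\Pi E_{M^*})$ on $\Pi L_M$ is the coarsest one for which all maps $U\mapsto\sum_{i=0}^{N}\int_O U_iw_i\,dz$ with $w\in \Pi E_{M^*}=E_{M^*}(O)^{N+1}$ are continuous. As usual, functions equal a.e. are identified. For complementary $\Phi$-functions $\Psi,\Psi^*$ on $\Omega$, $W^1L_\Psi(\Omega)$ is the set of $v\in L_\Psi(\Omega)$ with $\nabla v\in L_\Psi(\Omega)^N$, and $W^1_0L_\Psi(\Omega)$ is the closure of $C_0^\infty(\Omega)$ in $W^1L_\Psi(\Omega)$ for $\sigma(\Pi L_\Psi,\Pi E_{\Psi^*})$. Put $$W^{1,x}L_M(\Omega_T)=\{u\in L_M(\Omega_T):\ \nabla u\in L_M(\Omega_T)^N\},$$ $$W^{1,x}_0L_M(\Omega_T)=\{u\in W^{1,x}L_M(\Omega_T):\ u(t,\cdot)\in W^1_0L_{M(t,\cdot,\cdot)}(\Omega)\ \text{for a.e. } t\in(0,T)\}.$$ Theorem. Let $(M,M^*)$ be a pair of complementary $\Phi$-functions on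 $\Omega_T$, both locally integrable on $\Omega_T$. Then $$W^{1,x}_0L_M(\Omega_T)=\overline{C_0^\infty(\Omega_T)}^{\,\sigma(\Pi L_M,\Pi E_{M^*})},$$ where the closure is taken in $\Pi L_M$. (The left side being contained in $W^{1,x}L_M(\Omega_T)$, it is also the closure of $C_0^\infty(\Omega_T)$ in $W^{1,x}L_M(\Omega_T)$.) -/

import Mathlib

open Set Filter Topology MeasureTheory
open scoped NNReal ENNReal ContDiff

noncomputable section

namespace Musielak

/-- `M` is a `Φ`-function on `O`.  Measurability is Lebesgue measurability on `O`; values of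
`M x` for `x` outside `O`, or in a null subset of `O`, are irrelevant. -/
structure IsPhi {α : Type*} [MeasureSpace α] (O : Set α) (M : α → ℝ≥0 → ℝ≥0) : Prop where
  aemeasurable : ∀ s : ℝ≥0, AEMeasurable (fun x => M x s) (volume.restrict O)
  ae_convexOn : ∀ᵐ x ∂volume.restrict O, ConvexOn ℝ≥0 univ (M x)
  ae_zero : ∀ᵐ x ∂volume.restrict O, M x 0 = 0
  ae_pos : ∀ᵐ x ∂volume.restrict O, ∀ s : ℝ≥0, 0 < s → 0 < M x s
  ae_tendsto : ∀ᵐ x ∂volume.restrict O, Tendsto (M x) atTop atTop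
  ae_tendsto_div_zero : ∀ᵐ x ∂volume.restrict O,
    Tendsto (fun s : ℝ≥0 => M x s / s) (𝓝[>] 0) (𝓝 0)
  ae_tendsto_div_atTop : ∀ᵐ x ∂volume.restrict O,
    Tendsto (fun s : ℝ≥0 => M x s / s) atTop atTop

/-- `(M, M')` is a pair of complementary `Φ`-functions on `O`:
`M' x s = sup_{r ≥ 0} (s r - M x r)` for all `s ≥ 0` and almost every `x ∈ O`. -/
structure IsComplementaryPair {α : Type*} [MeasureSpace α] (O : Set α)
    (M M' : α → ℝ≥0 → ℝ≥0) : Prop where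
  left : IsPhi O M
  right : IsPhi O M'
  ae_isLUB : ∀ᵐ x ∂volume.restrict O, ∀ s : ℝ≥0,
    IsLUB (range fun r : ℝ≥0 => (s : ℝ) * (r : ℝ) - (M x r : ℝ)) (M' x s : ℝ)

/-- Local integrability of a `Φ`-function on `O`. -/
def IsLocInt {α : Type*} [TopologicalSpace α] [MeasureSpace α] (O : Set α)
    (M : α → ℝ≥0 → ℝ≥0) : Prop :=
  ∀ c : ℝ≥0, 0 < c → ∀ K : Set α, IsCompact K → K ⊆ O →
    ∫⁻ x in K, (M x c : ℝ≥0∞) < ⊤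

/-- The modular `∫_O M(x, |u(x)| / l) dx`. -/
def modular {α : Type*} [MeasureSpace α] (O : Set α) (M : α → ℝ≥0 → ℝ≥0)
    (l : ℝ≥0) (u : α → ℝ) : ℝ≥0∞ :=
  ∫⁻ x in O, (M x (‖u x‖₊ / l) : ℝ≥0∞)

/-- The Musielak space `L_M(O)`, as a set of Lebesgue measurable functions on `O`
(functions are total; only their restrictions to `O`, up to null sets, matter). -/
def MemL {α : Type*} [MeasureSpace α] (O : Set α) (M : α → ℝ≥0 → ℝ≥0) (u : α → ℝ) : Prop :=
  AEMeasurable u (volume.restrict O) ∧ ∃ l : ℝ≥0, 0 < l ∧ modular O M l u < ⊤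

/-- The space `E_M(O)`. -/
def MemE {α : Type*} [MeasureSpace α] (O : Set α) (M : α → ℝ≥0 → ℝ≥0) (u : α → ℝ) : Prop :=
  AEMeasurable u (volume.restrict O) ∧ ∀ l : ℝ≥0, 0 < l → modular O M l u < ⊤

/-- The product `Π L_M` of `N + 1` copies of `L_M(O)`. -/
def ProdL {α : Type*} [MeasureSpace α] (O : Set α) (M : α → ℝ≥0 → ℝ≥0) (N : ℕ) : Type _ :=
  {U : Fin (N + 1) → α → ℝ // ∀ i, MemL O M (U i)}

/-- The product `Π E_M` of `N + 1` copies of `E_M(O)`. -/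
def ProdE {α : Type*} [MeasureSpace α] (O : Set α) (M : α → ℝ≥0 → ℝ≥0) (N : ℕ) : Type _ :=
  {w : Fin (N + 1) → α → ℝ // ∀ i, MemE O M (w i)}

/-- The topology `σ(Π L_M, Π E_{M'})` on `Π L_M`: the coarsest topology making
`U ↦ ∑ i, ∫_O U_i w_i` continuous for every `w ∈ Π E_{M'}`. Functions that agree almost everywhere
on `O` are topologically indistinguishable, so closures are unions of a.e.-equivalence classes. -/
@[reducible] def weakStar {α : Type*} [MeasureSpace α] (O : Set α) (M M' : α → ℝ≥0 → ℝ≥0) (N : ℕ) :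
    TopologicalSpace (ProdL O M N) :=
  TopologicalSpace.induced
    (fun (U : ProdL O M N) (w : ProdE O M' N) => ∑ i, ∫ x in O, U.1 i x * w.1 i x)
    Pi.topologicalSpace

/-- `C_0^∞(O)`: smooth functions with compact support contained in `O`. -/
def IsTest {α : Type*} [NormedAddCommGroup α] [NormedSpace ℝ α] (O : Set α) (φ : α → ℝ) : Prop :=
  ContDiff ℝ ∞ φ ∧ HasCompactSupport φ ∧ tsupport φ ⊆ O

/-- `g` is the weak (distributional) derivative of `u` on `O` in the direction `e`. -/
def HasWeakDeriv {α : Type*} [NormedAddCommGroup α] [NormedSpace ℝ α] [MeasureSpace α]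
    (O : Set α) (e : α) (u g : α → ℝ) : Prop :=
  LocallyIntegrableOn u O ∧ LocallyIntegrableOn g O ∧
    ∀ φ : α → ℝ, IsTest O φ → ∫ x in O, u x * fderiv ℝ φ x e = - ∫ x in O, g x * φ x

/-- The functions `u ∈ L_M(O)` whose weak derivatives in the directions `e 1, …, e N` belong to
`L_M(O)`, identified with the tuples `(u, ∂_1 u, …, ∂_N u)` in `Π L_M`. -/
def sobolev {α : Type*} [NormedAddCommGroup α] [NormedSpace ℝ α] [MeasureSpace α]
    (O : Set α) (M : α → ℝ≥0 → ℝ≥0) {N : ℕ} (e : Fin N → α) : Set (ProdL O M N) :=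
  {U | ∀ i : Fin N, HasWeakDeriv O (e i) (U.1 0) (U.1 i.succ)}

/-- `C_0^∞(O)` in `Π L_M`, through `φ ↦ (φ, ∂_1 φ, …, ∂_N φ)`. -/
def testFunctions {α : Type*} [NormedAddCommGroup α] [NormedSpace ℝ α] [MeasureSpace α]
    (O : Set α) (M : α → ℝ≥0 → ℝ≥0) {N : ℕ} (e : Fin N → α) : Set (ProdL O M N) :=
  {U | IsTest O (U.1 0) ∧ ∀ i : Fin N, U.1 i.succ = fun x => fderiv ℝ (U.1 0) x (e i)}

/-- The coordinate directions of `ℝ^N`. -/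
def dir (N : ℕ) (i : Fin N) : EuclideanSpace ℝ (Fin N) := EuclideanSpace.single i 1

/-- The spatial coordinate directions of `ℝ × ℝ^N`. -/
def spaceDir (N : ℕ) (i : Fin N) : ℝ × EuclideanSpace ℝ (Fin N) := (0, dir N i)

/-- The space `W^1_0 L_M(Ω)`, a set of functions on `Ω`: the closure of `C_0^∞(Ω)` in `W^1 L_M(Ω)`
for the topology `σ(Π L_M, Π E_{M'})`. -/
def W10L {N : ℕ} (Ω : Set (EuclideanSpace ℝ (Fin N)))
    (M M' : EuclideanSpace ℝ (Fin N) → ℝ≥0 → ℝ≥0) : Set (EuclideanSpace ℝ (Fin N) → ℝ) :=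
  {u | ∃ V ∈ sobolev Ω M (dir N) ∩ closure[weakStar Ω M M' N] (testFunctions Ω M (dir N)),
    V.1 0 = u}

/-- The space-time cylinder `Ω_T = (0,T) × Ω`. -/
def cylinder {N : ℕ} (T : ℝ) (Ω : Set (EuclideanSpace ℝ (Fin N))) :
    Set (ℝ × EuclideanSpace ℝ (Fin N)) :=
  Ioo 0 T ×ˢ Ω

/-- The space `W^{1,x} L_M(Ω_T)`, identified with a subset of `Π L_M`. -/
def W1xL {N : ℕ} (T : ℝ) (Ω : Set (EuclideanSpace ℝ (Fin N)))
    (M : ℝ × EuclideanSpace ℝ (Fin N) → ℝ≥0 → ℝ≥0) : Set (ProdL (cylinder T Ω) M N) :=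
  sobolev (cylinder T Ω) M (spaceDir N)

/-- The space `W^{1,x}_0 L_M(Ω_T)`, identified with a subset of `Π L_M`: the `u` with
`u ∈ L_M(Ω_T)`, `∇u ∈ L_M(Ω_T)^N` and `u(t,·) ∈ W^1_0 L_{M(t,·)}(Ω)` for almost every `t`. -/
def W1x0L {N : ℕ} (T : ℝ) (Ω : Set (EuclideanSpace ℝ (Fin N)))
    (M M' : ℝ × EuclideanSpace ℝ (Fin N) → ℝ≥0 → ℝ≥0) : Set (ProdL (cylinder T Ω) M N) :=
  {U | U ∈ W1xL T Ω M ∧ ∀ᵐ t ∂volume.restrict (Ioo 0 T),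
    (fun x => U.1 0 (t, x)) ∈ W10L Ω (fun x => M (t, x)) (fun x => M' (t, x))}

end Musielak

end

/-! By finite-dimensional duality a tuple `U` lies in the weak closure of the test functions iff
every `w` in `Π E_{M'}` that annihilates all jets `(φ, ∇φ)` annihilates `U`
(`mem_closure_testFunctions_iff`). This applies on the cylinder and, at almost every time, on `Ω`,
so the theorem compares annihilators on the cylinder with annihilators on its time slices.

From slices to the cylinder: if `w` annihilates the test functions of the cylinder, testing with
products `η(t) φ(x)`, where `φ` runs through a countable determining family, shows that `w(t)`
annihilates the test functions of `Ω` for a.e. `t` (`ae_pairing_slice_eq_zero`). The same lemma,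
applied to `U` with entries swapped, shows that `∇U(t)` is the weak gradient of `U(t)`. Hence the
slices of `U` and `w` pair to zero, and Fubini concludes.

From the cylinder to slices: suppose that at times of a set of positive outer measure some `v_t`
annihilates the test functions of `Ω` but not `U(t)`. A measurable choice of `v_t` would be an
annihilator on the cylinder that does not kill `U`. The bad set is not known to be measurable and
the spaces `E_{M'(t)}` vary with `t`, so `v_t` is encoded by a sequence of indices into one
countable family of bounded, compactly supported functions, modularly dense in all these spaces at
once (`exists_countable_dense`). Being Cauchy and solving the equations approximately are then
conditions on the indices that form a Souslin scheme. `exists_selection` chooses a branch measurably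
on a set of positive measure, with the `k`-th index bounded by some `n k`. The bound keeps the
approximants in `E_{M'}` of the cylinder, and `exists_limit_of_modular_cauchy` provides the limit
(`exists_measurable_solution`). -/

namespace Musielak

/-! ### Convex functions on the half-line -/

section Convex

variable {f : ℝ≥0 → ℝ≥0}

theorem convex_map_mul_le (hf : ConvexOn ℝ≥0 univ f) (h0 : f 0 = 0) {c : ℝ≥0} (hc : c ≤ 1)
    (s : ℝ≥0) : f (c * s) ≤ c * f s := by
  have := hf.2 (mem_univ s) (mem_univ 0) (zero_le (a := c)) (zero_le (a := 1 - c))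
    (add_tsub_cancel_of_le hc)
  simpa [h0] using this

theorem convex_monotone (hf : ConvexOn ℝ≥0 univ f) (h0 : f 0 = 0) : Monotone f := by
  intro s t hst
  rcases eq_or_ne t 0 with rfl | ht
  · simp [le_antisymm hst (zero_le)]
  · have h1 : s / t ≤ 1 := div_le_one_of_le₀ hst (zero_le)
    have := convex_map_mul_le hf h0 h1 t
    rw [div_mul_cancel₀ _ ht] at this
    exact this.trans (mul_le_of_le_one_left (zero_le) h1)

theorem convex_map_half_add_le (hf : ConvexOn ℝ≥0 univ f) (s t : ℝ≥0) :
    f ((s + t) / 2) ≤ f s / 2 + f t / 2 := by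
  have h2 : (2⁻¹ : ℝ≥0) + 2⁻¹ = 1 := by
    rw [← two_mul]; exact mul_inv_cancel₀ two_ne_zero
  have := hf.2 (mem_univ s) (mem_univ t) (zero_le (a := 2⁻¹)) (zero_le (a := 2⁻¹)) h2
  simp only [smul_eq_mul] at this
  have e1 : (s + t) / 2 = 2⁻¹ * s + 2⁻¹ * t := by ring
  rw [e1]
  refine this.trans (le_of_eq ?_)
  ring

/-- The extension `r ↦ f r⁺` to `ℝ` is convex because `f` is monotone, and convex functions on open
sets are continuous; the extension takes care of the endpoint `0`. -/
theorem convex_continuous (hf : ConvexOn ℝ≥0 univ f) (h0 : f 0 = 0) : Continuous f := by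
  have hm := convex_monotone hf h0
  have hc : ConvexOn ℝ univ (fun r : ℝ => (f r.toNNReal : ℝ)) := by
    refine ⟨convex_univ, fun x _ y _ a b ha hb hab => ?_⟩
    lift a to ℝ≥0 using ha
    lift b to ℝ≥0 using hb
    have h1 : ((a : ℝ) • x + (b : ℝ) • y).toNNReal ≤ a • x.toNNReal + b • y.toNNReal := by
      rw [Real.toNNReal_le_iff_le_coe]
      push_cast
      simp only [smul_eq_mul, NNReal.coe_mul, Real.coe_toNNReal']
      gcongr <;> exact le_max_left _ _
    have h2 := (hm h1).trans (hf.2 (mem_univ x.toNNReal) (mem_univ y.toNNReal)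
      (zero_le (a := a)) (zero_le (a := b)) (by exact_mod_cast hab))
    exact_mod_cast h2
  have h1 : Continuous (fun r : ℝ => (f r.toNNReal : ℝ)) :=
    continuousOn_univ.1 (hc.continuousOn isOpen_univ)
  have h2 : Continuous (fun s : ℝ≥0 => (f s : ℝ)) := by
    simpa [Function.comp_def] using h1.comp NNReal.continuous_coe
  exact NNReal.isEmbedding_coe.continuous_iff.2 h2

end Convex

/-- For simple `g` the composition is a finite sum of restricted sections; continuity of `M x`
passes to limits of simple functions. -/
theorem aemeasurable_caratheodory {α : Type*} [MeasurableSpace α] {μ : Measure α}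
    {M : α → ℝ≥0 → ℝ≥0} (hM : ∀ s, AEMeasurable (fun x => M x s) μ)
    (hc : ∀ᵐ x ∂μ, Continuous (M x)) {g : α → ℝ≥0} (hg : AEMeasurable g μ) :
    AEMeasurable (fun x => M x (g x)) μ := by
  obtain ⟨g', hg', hgg'⟩ := hg
  suffices h : AEMeasurable (fun x => M x (g' x)) μ by
    refine h.congr ?_
    filter_upwards [hgg'] with x hx
    rw [hx]
  have hsimple : ∀ s : SimpleFunc α ℝ≥0, AEMeasurable (fun x => M x (s x)) μ := by
    intro s
    have : (fun x => M x (s x)) =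
        fun x => ∑ y ∈ s.range, (s ⁻¹' {y}).indicator (fun x => M x y) x := by
      funext x
      rw [Finset.sum_eq_single (s x)]
      · simp
      · intro b _ hb
        exact indicator_of_notMem (fun h => hb (by simpa using h.symm)) _
      · intro h; exact absurd (s.mem_range_self x) h
    rw [this]
    exact Finset.aemeasurable_fun_sum _ fun y _ => (hM y).indicator (s.measurableSet_fiber y)
  refine aemeasurable_of_tendsto_metrizable_ae atTop
    (f := fun n x => M x (SimpleFunc.approxOn g' hg' univ 0 (mem_univ _) n x))
    (fun n => hsimple _) ?_
  filter_upwards [hc] with x hx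
  exact (hx.tendsto _).comp (SimpleFunc.tendsto_approxOn hg' (mem_univ _) (by simp))

/-! ### Modulars, Young's inequality and local integrability -/

section Modular

variable {α : Type*} [MeasureSpace α] {O : Set α} {M M' : α → ℝ≥0 → ℝ≥0}

theorem IsPhi.ae_monotone (h : IsPhi O M) : ∀ᵐ x ∂volume.restrict O, Monotone (M x) := by
  filter_upwards [h.ae_convexOn, h.ae_zero] with x h1 h2 using convex_monotone h1 h2

theorem IsPhi.ae_continuous (h : IsPhi O M) : ∀ᵐ x ∂volume.restrict O, Continuous (M x) := by
  filter_upwards [h.ae_convexOn, h.ae_zero] with x h1 h2 using convex_continuous h1 h2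

theorem IsPhi.aemeasurable_comp (h : IsPhi O M) {u : α → ℝ}
    (hu : AEMeasurable u (volume.restrict O)) (l : ℝ≥0) :
    AEMeasurable (fun x => (M x (‖u x‖₊ / l) : ℝ≥0∞)) (volume.restrict O) :=
  (aemeasurable_caratheodory h.aemeasurable h.ae_continuous
    (hu.nnnorm.div_const l)).coe_nnreal_ennreal

theorem IsPhi.modular_mono (h : IsPhi O M) {l k : ℝ≥0} {u v : α → ℝ}
    (huv : ∀ᵐ x ∂volume.restrict O, ‖u x‖₊ / l ≤ ‖v x‖₊ / k) :
    modular O M l u ≤ modular O M k v := by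
  refine lintegral_mono_ae ?_
  filter_upwards [h.ae_monotone, huv] with x h1 h2
  exact_mod_cast h1 h2

theorem IsPhi.modular_anti (h : IsPhi O M) {l k : ℝ≥0} (hk : 0 < k) (hl : k ≤ l) (u : α → ℝ) :
    modular O M l u ≤ modular O M k u :=
  h.modular_mono (Eventually.of_forall fun _ => by gcongr)

/-- Midpoint convexity replaces the triangle inequality: a sum is split at the price of halving the
scale. -/
theorem IsPhi.modular_half (h : IsPhi O M) {l : ℝ≥0} {u v w : α → ℝ}
    (hv : AEMeasurable v (volume.restrict O))
    (huv : ∀ᵐ x ∂volume.restrict O, ‖u x‖₊ ≤ ‖v x‖₊ + ‖w x‖₊) :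
    modular O M l u ≤ modular O M (l / 2) v / 2 + modular O M (l / 2) w / 2 := by
  have h2 : (2 : ℝ≥0∞) ≠ 0 := two_ne_zero
  unfold modular
  simp only [div_eq_mul_inv _ (2 : ℝ≥0∞)]
  rw [← lintegral_mul_const'' _ (h.aemeasurable_comp hv _),
    ← lintegral_mul_const' _ _ (ENNReal.inv_ne_top.2 h2),
    ← lintegral_add_left' ((h.aemeasurable_comp hv _).mul_const _)]
  refine lintegral_mono_ae ?_
  filter_upwards [h.ae_convexOn, h.ae_monotone, huv] with x h1 hm h3
  have h4 : ‖u x‖₊ / l ≤ (‖v x‖₊ / (l / 2) + ‖w x‖₊ / (l / 2)) / 2 := by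
    rw [← add_div, div_div, div_mul_cancel₀ _ two_ne_zero]
    gcongr
  have h5 := (hm h4).trans (convex_map_half_add_le h1 _ _)
  have h6 : ((M x (‖u x‖₊ / l) : ℝ≥0) : ℝ≥0∞) ≤
    ((M x (‖v x‖₊ / (l / 2)) / 2 + M x (‖w x‖₊ / (l / 2)) / 2 : ℝ≥0) : ℝ≥0∞) := by
      exact_mod_cast h5
  refine h6.trans (le_of_eq ?_)
  rw [ENNReal.coe_add, ENNReal.coe_div two_ne_zero, ENNReal.coe_div two_ne_zero]
  simp [div_eq_mul_inv]

theorem IsPhi.memE_add (h : IsPhi O M) {u v : α → ℝ} (hu : MemE O M u) (hv : MemE O M v) :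
    MemE O M (fun x => u x + v x) := by
  refine ⟨hu.1.add hv.1, fun l hl => ?_⟩
  refine (h.modular_half (u := fun x => u x + v x) (w := v) hu.1
    (Eventually.of_forall fun x => nnnorm_add_le _ _)).trans_lt ?_
  have hl2 : 0 < l / 2 := by positivity
  exact ENNReal.add_lt_top.2 ⟨ENNReal.div_lt_top (hu.2 _ hl2).ne two_ne_zero,
    ENNReal.div_lt_top (hv.2 _ hl2).ne two_ne_zero⟩

theorem IsPhi.modular_zero (h : IsPhi O M) (l : ℝ≥0) : modular O M l (fun _ => 0) = 0 := by
  unfold modular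
  rw [lintegral_congr_ae (g := fun _ => 0)]
  · simp
  · filter_upwards [h.ae_zero] with x hx
    simp [hx]

theorem IsPhi.memE_zero (h : IsPhi O M) : MemE O M (fun _ => 0) :=
  ⟨aemeasurable_const, fun l _ => by simp [h.modular_zero]⟩

theorem IsPhi.memE_const_mul (h : IsPhi O M) {u : α → ℝ} (hu : MemE O M u) (c : ℝ) :
    MemE O M (fun x => c * u x) := by
  refine ⟨hu.1.const_mul c, fun l hl => ?_⟩
  refine (h.modular_mono (k := l / (‖c‖₊ + 1)) (v := u) (Eventually.of_forall fun x => ?_)).trans_lt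
    (hu.2 _ (by positivity))
  rw [nnnorm_mul, div_div_eq_mul_div, mul_comm]
  gcongr
  simp

theorem IsPhi.memE_sum (h : IsPhi O M) {ι : Type*} (s : Finset ι) {u : ι → α → ℝ}
    (hu : ∀ i ∈ s, MemE O M (u i)) : MemE O M (fun x => ∑ i ∈ s, u i x) := by
  classical
  induction s using Finset.induction_on with
  | empty => simpa using h.memE_zero
  | insert a s ha ih =>
    simp only [Finset.sum_insert ha]
    exact h.memE_add (hu a (by simp)) (ih fun i hi => hu i (by simp [hi]))

theorem MemE.memL {u : α → ℝ} (hu : MemE O M u) : MemL O M u :=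
  ⟨hu.1, 1, one_pos, hu.2 1 one_pos⟩

theorem IsPhi.memE_of_bounded [TopologicalSpace α] [OpensMeasurableSpace α] [T2Space α]
    (h : IsPhi O M) (hM : IsLocInt O M) {u : α → ℝ}
    (hu : AEMeasurable u (volume.restrict O)) {c : ℝ≥0} (hc : ∀ x, ‖u x‖₊ ≤ c) {K : Set α}
    (hK : IsCompact K) (hKO : K ⊆ O) (hs : ∀ x ∉ K, u x = 0) : MemE O M u := by
  refine ⟨hu, fun l hl => ?_⟩
  -- The `+ 1` keeps the argument positive, as `IsLocInt` requires, even when `c = 0`.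
  have h1 : modular O M l u ≤ ∫⁻ x in K, (M x ((c + 1) / l) : ℝ≥0∞) := by
    rw [← inter_eq_self_of_subset_left hKO, ← Measure.restrict_restrict hK.measurableSet,
      ← lintegral_indicator hK.measurableSet]
    refine lintegral_mono_ae ?_
    filter_upwards [h.ae_zero, h.ae_monotone] with x h0 hm
    by_cases hx : x ∈ K
    · rw [indicator_of_mem hx]
      have : ‖u x‖₊ / l ≤ (c + 1) / l := by
        gcongr; exact (hc x).trans (by simp)
      exact_mod_cast hm this
    · rw [indicator_of_notMem hx, hs x hx]
      simp [h0]
  exact h1.trans_lt (hM _ (by positivity) K hK hKO)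

theorem IsComplementaryPair.ae_young (h : IsComplementaryPair O M M') :
    ∀ᵐ x ∂volume.restrict O, ∀ r s : ℝ≥0, r * s ≤ M x r + M' x s := by
  filter_upwards [h.ae_isLUB] with x hx r s
  have := (hx s).1 ⟨r, rfl⟩
  simp only at this
  have h2 : (r : ℝ) * s ≤ M x r + M' x s := by linarith [mul_comm (r : ℝ) s]
  exact_mod_cast h2

/-- Young's inequality for `|u| / a` and `|v| / b`. The free scales later make a pairing small when
`v` has bounded modular at a small scale `b`. -/
theorem IsComplementaryPair.lintegral_mul_le (h : IsComplementaryPair O M M') {u v : α → ℝ}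
    (hu : AEMeasurable u (volume.restrict O)) {a b : ℝ≥0} (ha : 0 < a) (hb : 0 < b) :
    ∫⁻ x in O, ‖u x * v x‖ₑ ≤ a * b * (modular O M a u + modular O M' b v) := by
  unfold modular
  rw [← lintegral_add_left' (h.left.aemeasurable_comp hu _),
    ← lintegral_const_mul' _ _ (by simpa using ENNReal.mul_ne_top (by simp) (by simp))]
  refine lintegral_mono_ae ?_
  filter_upwards [h.ae_young] with x hx
  have h1 := hx (‖u x‖₊ / a) (‖v x‖₊ / b)
  have h2 : ‖u x‖₊ * ‖v x‖₊ ≤ a * b * (M x (‖u x‖₊ / a) + M' x (‖v x‖₊ / b)) := by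
    calc ‖u x‖₊ * ‖v x‖₊ = a * b * (‖u x‖₊ / a * (‖v x‖₊ / b)) := by field_simp
      _ ≤ _ := by gcongr
  rw [enorm_eq_nnnorm, nnnorm_mul]
  exact_mod_cast h2

theorem IsComplementaryPair.integrable_mul (h : IsComplementaryPair O M M') {u v : α → ℝ}
    (hu : MemL O M u) (hv : MemE O M' v) : IntegrableOn (fun x => u x * v x) O := by
  obtain ⟨h1, l, hl, h2⟩ := hu
  refine ⟨(h1.mul hv.1).aestronglyMeasurable, ?_⟩
  refine (h.lintegral_mul_le h1 hl one_pos).trans_lt ?_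
  exact ENNReal.mul_lt_top (by simp) (ENNReal.add_lt_top.2 ⟨h2, hv.2 1 one_pos⟩)

theorem IsComplementaryPair.norm_integral_mul_le (h : IsComplementaryPair O M M') {u v : α → ℝ}
    (hu : AEMeasurable u (volume.restrict O)) {a b : ℝ≥0} (ha : 0 < a) (hb : 0 < b)
    (h1 : modular O M a u ≠ ⊤) (h2 : modular O M' b v ≠ ⊤) :
    |∫ x in O, u x * v x| ≤ a * b * ((modular O M a u).toReal + (modular O M' b v).toReal) := by
  rw [← Real.norm_eq_abs]
  refine (norm_integral_le_lintegral_norm _).trans ?_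
  have h3 := ENNReal.toReal_mono ?_ (h.lintegral_mul_le (v := v) hu ha hb)
  · simp only [ofReal_norm]
    refine h3.trans (le_of_eq ?_)
    rw [ENNReal.toReal_mul, ENNReal.toReal_add h1 h2]
    simp
  · exact ENNReal.mul_ne_top (by simpa using ENNReal.mul_ne_top (by simp) (by simp))
      (ENNReal.add_ne_top.2 ⟨h1, h2⟩)

theorem indicator_memE [TopologicalSpace α] [OpensMeasurableSpace α] [T2Space α]
    (h : IsPhi O M) (hM : IsLocInt O M) {K : Set α}
    (hK : IsCompact K) (hKO : K ⊆ O) : MemE O M (K.indicator fun _ => (1 : ℝ)) :=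
  h.memE_of_bounded hM (aemeasurable_const.indicator hK.measurableSet) (c := 1)
    (fun x => by by_cases hx : x ∈ K <;> simp [hx]) hK hKO (fun x hx => by simp [hx])

theorem integrableOn_of_indicator_mul [TopologicalSpace α] [OpensMeasurableSpace α] [T2Space α]
    {u : α → ℝ} {K : Set α} (hK : IsCompact K) (hKO : K ⊆ O)
    (hu : IntegrableOn (fun x => u x * K.indicator (fun _ => (1 : ℝ)) x) O) :
    IntegrableOn u K := by
  refine (hu.mono_set hKO).congr_fun (fun x hx => ?_) hK.measurableSet
  simp [hx]

variable [TopologicalSpace α] [OpensMeasurableSpace α] [T2Space α] [LocallyCompactSpace α]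

/-- Indicators of compact subsets of `O` lie in `E_{M'}`, so integrability on them is a case of
integrability of products. -/
theorem IsComplementaryPair.locallyIntegrableOn_left (h : IsComplementaryPair O M M')
    (hO : IsOpen O) (hM' : IsLocInt O M') {u : α → ℝ} (hu : MemL O M u) :
    LocallyIntegrableOn u O := by
  rw [locallyIntegrableOn_iff hO.isLocallyClosed]
  intro K hKO hK
  exact integrableOn_of_indicator_mul hK hKO
    (h.integrable_mul hu (indicator_memE h.right hM' hK hKO))

theorem IsComplementaryPair.locallyIntegrableOn_right (h : IsComplementaryPair O M M')
    (hO : IsOpen O) (hM : IsLocInt O M) {u : α → ℝ} (hu : MemE O M' u) :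
    LocallyIntegrableOn u O := by
  rw [locallyIntegrableOn_iff hO.isLocallyClosed]
  intro K hKO hK
  refine integrableOn_of_indicator_mul hK hKO ?_
  simpa only [mul_comm] using
    h.integrable_mul (indicator_memE h.left hM hK hKO).memL hu

end Modular

/-! ### Finite-dimensional duality and the pairing -/

/-- A basic neighbourhood constrains finitely many coordinates. If the projection of `x` to these
were outside that of `S`, a functional on a finite-dimensional space would separate them. -/
theorem mem_closure_of_forall_sum_eq_zero {ι : Type*} (S : Submodule ℝ (ι → ℝ)) (x : ι → ℝ)
    (h : ∀ (s : Finset ι) (c : ι → ℝ), (∀ y ∈ S, ∑ i ∈ s, c i * y i = 0) →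
      ∑ i ∈ s, c i * x i = 0) : x ∈ closure (S : Set (ι → ℝ)) := by
  classical
  rw [mem_closure_iff_nhds]
  intro V hV
  rw [nhds_pi, Filter.mem_pi] at hV
  obtain ⟨I, hI, t, ht, htV⟩ := hV
  let r : (ι → ℝ) →ₗ[ℝ] (hI.toFinset → ℝ) := LinearMap.funLeft ℝ ℝ Subtype.val
  by_cases hx : r x ∈ S.map r
  · obtain ⟨y, hyS, hy⟩ := hx
    refine ⟨y, htV fun i hi => ?_, hyS⟩
    have : y i = x i := congrFun hy ⟨i, hI.mem_toFinset.2 hi⟩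
    rw [this]
    exact mem_of_mem_nhds (ht i)
  · exfalso
    obtain ⟨f, hfx, hf⟩ := Submodule.exists_le_ker_of_notMem hx
    let c : ι → ℝ := fun i => if hi : i ∈ hI.toFinset then f (Pi.single ⟨i, hi⟩ 1) else 0
    have hsum : ∀ y, ∑ i ∈ hI.toFinset, c i * y i = f (r y) := by
      intro y
      rw [LinearMap.pi_apply_eq_sum_univ f (r y), ← Finset.sum_attach]
      refine Finset.sum_congr (by ext; simp) fun i _ => ?_
      simp only [c, i.2, dif_pos, smul_eq_mul, mul_comm]
      have e : (fun j => if i = j then (1 : ℝ) else 0) = Pi.single i 1 := by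
        funext j; simp [Pi.single_apply, eq_comm]
      rw [e]
      rfl
    refine hfx ?_
    rw [← hsum]
    refine h _ _ fun y hy => ?_
    rw [hsum]
    exact hf (Submodule.mem_map_of_mem hy)

/-- The pairing `∑ i, ∫_O U_i w_i`. -/
noncomputable def pairing {α : Type*} [MeasureSpace α] (O : Set α) {N : ℕ}
    (U w : Fin (N + 1) → α → ℝ) : ℝ := ∑ i, ∫ x in O, U i x * w i x

/-- The tuple `(φ, ∂_1 φ, …, ∂_N φ)`. -/
noncomputable def jet {α : Type*} [NormedAddCommGroup α] [NormedSpace ℝ α] {N : ℕ}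
    (e : Fin N → α) (φ : α → ℝ) : Fin (N + 1) → α → ℝ :=
  Fin.cons φ fun i x => fderiv ℝ φ x (e i)

/-- The tuple with entries `U_{i+1}` at `0` and `U_0` at `i + 1`. -/
def swapAt {α : Type*} {N : ℕ} (i : Fin N) (U : Fin (N + 1) → α → ℝ) : Fin (N + 1) → α → ℝ :=
  Fin.cons (U i.succ) (Pi.single i (U 0))

section Pairing

variable {α : Type*} [MeasureSpace α] {O : Set α} {M M' : α → ℝ≥0 → ℝ≥0} {N : ℕ}

theorem pairing_comm (U w : Fin (N + 1) → α → ℝ) : pairing O U w = pairing O w U := by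
  simp only [pairing, mul_comm]

theorem pairing_congr {U V w : Fin (N + 1) → α → ℝ}
    (h : ∀ i, U i =ᵐ[volume.restrict O] V i) : pairing O U w = pairing O V w := by
  refine Finset.sum_congr rfl fun i _ => integral_congr_ae ?_
  filter_upwards [h i] with x hx
  rw [hx]

theorem pairing_congr_right {U w z : Fin (N + 1) → α → ℝ}
    (h : ∀ i, w i =ᵐ[volume.restrict O] z i) : pairing O U w = pairing O U z := by
  rw [pairing_comm, pairing_congr h, pairing_comm]

theorem pairing_swapAt (i : Fin N) (U w : Fin (N + 1) → α → ℝ) :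
    pairing O U (swapAt i w) = (∫ x in O, U 0 x * w i.succ x) + ∫ x in O, U i.succ x * w 0 x := by
  rw [pairing, Fin.sum_univ_succ, Finset.sum_eq_single i]
  · simp [swapAt]
  · intro j _ hj
    simp [swapAt, hj]
  · simp

theorem pairing_add_left {U V w : Fin (N + 1) → α → ℝ}
    (hU : ∀ i, IntegrableOn (fun x => U i x * w i x) O)
    (hV : ∀ i, IntegrableOn (fun x => V i x * w i x) O) :
    pairing O (fun i x => U i x + V i x) w = pairing O U w + pairing O V w := by
  simp only [pairing, ← Finset.sum_add_distrib]
  refine Finset.sum_congr rfl fun i _ => ?_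
  rw [← integral_add (hU i) (hV i)]
  simp only [add_mul]

theorem pairing_const_mul_left (c : ℝ) (U w : Fin (N + 1) → α → ℝ) :
    pairing O (fun i x => c * U i x) w = c * pairing O U w := by
  simp only [pairing, Finset.mul_sum, ← integral_const_mul, mul_assoc]

theorem pairing_const_mul_right (c : ℝ) (U w : Fin (N + 1) → α → ℝ) :
    pairing O U (fun i x => c * w i x) = c * pairing O U w := by
  rw [pairing_comm, pairing_const_mul_left, pairing_comm]

theorem pairing_sum_right {ι : Type*} (s : Finset ι) (c : ι → ℝ) {U : Fin (N + 1) → α → ℝ}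
    {w : ι → Fin (N + 1) → α → ℝ}
    (hw : ∀ j ∈ s, ∀ i, IntegrableOn (fun x => U i x * w j i x) O) :
    pairing O U (fun i x => ∑ j ∈ s, c j * w j i x) = ∑ j ∈ s, c j * pairing O U (w j) := by
  simp only [pairing, Finset.mul_sum]
  rw [Finset.sum_comm]
  refine Finset.sum_congr rfl fun i _ => ?_
  simp only [← integral_const_mul]
  rw [← integral_finsetSum _ fun j hj => (hw j hj i).const_mul (c j)]
  refine integral_congr_ae (Eventually.of_forall fun x => ?_)
  simp only [mul_left_comm]

end Pairing

/-! ### Jets of test functions and the annihilator criterion -/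

section Test

variable {α : Type*} [NormedAddCommGroup α] [NormedSpace ℝ α] {O : Set α} {N : ℕ} {e : Fin N → α}

@[simp] theorem jet_zero (e : Fin N → α) (φ : α → ℝ) : jet e φ 0 = φ := rfl

@[simp] theorem jet_succ (e : Fin N → α) (φ : α → ℝ) (i : Fin N) :
    jet e φ i.succ = fun x => fderiv ℝ φ x (e i) := rfl

theorem IsTest.differentiable {φ : α → ℝ} (hφ : IsTest O φ) : Differentiable ℝ φ :=
  hφ.1.differentiable (by simp)

theorem IsTest.continuous_jet {φ : α → ℝ} (hφ : IsTest O φ) (e : Fin N → α) (i : Fin (N + 1)) :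
    Continuous (jet e φ i) := by
  refine Fin.cases hφ.1.continuous (fun i => ?_) i
  exact (hφ.1.continuous_fderiv (by simp)).clm_apply continuous_const

theorem tsupport_jet_subset (φ : α → ℝ) (e : Fin N → α) (i : Fin (N + 1)) :
    tsupport (jet e φ i) ⊆ tsupport φ := by
  refine Fin.cases subset_rfl (fun i => ?_) i
  exact tsupport_fderiv_apply_subset ℝ (e i)

theorem jet_eq_zero {φ : α → ℝ} {x : α} (hx : x ∉ tsupport φ) (e : Fin N → α) (i : Fin (N + 1)) :
    jet e φ i x = 0 := image_eq_zero_of_notMem_tsupport fun h => hx (tsupport_jet_subset φ e i h)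

theorem IsTest.hasCompactSupport_jet {φ : α → ℝ} (hφ : IsTest O φ) (e : Fin N → α)
    (i : Fin (N + 1)) : HasCompactSupport (jet e φ i) :=
  hφ.2.1.of_isClosed_subset (isClosed_tsupport _) (tsupport_jet_subset φ e i)

theorem IsTest.exists_bound_jet {φ : α → ℝ} (hφ : IsTest O φ) (e : Fin N → α) (i : Fin (N + 1)) :
    ∃ c : ℝ≥0, ∀ x, ‖jet e φ i x‖₊ ≤ c := by
  obtain ⟨c, hc⟩ := (hφ.hasCompactSupport_jet e i).exists_bound_of_continuous
    (hφ.continuous_jet e i)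
  exact ⟨c.toNNReal, fun x => NNReal.le_toNNReal_of_coe_le (hc x)⟩

theorem IsTest.add {φ ψ : α → ℝ} (hφ : IsTest O φ) (hψ : IsTest O ψ) :
    IsTest O fun x => φ x + ψ x :=
  ⟨hφ.1.add hψ.1, hφ.2.1.add hψ.2.1, (tsupport_add φ ψ).trans (union_subset hφ.2.2 hψ.2.2)⟩

theorem IsTest.const_mul {φ : α → ℝ} (hφ : IsTest O φ) (c : ℝ) : IsTest O fun x => c * φ x :=
  ⟨contDiff_const.mul hφ.1, hφ.2.1.mul_left,
    (tsupport_mul_subset_right (f := fun _ => c) (g := φ)).trans hφ.2.2⟩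

theorem isTest_zero : IsTest O fun _ : α => (0 : ℝ) :=
  ⟨contDiff_const, HasCompactSupport.zero, by
    have : tsupport (fun _ : α => (0 : ℝ)) = ∅ := tsupport_eq_empty_iff.2 rfl
    rw [this]; exact empty_subset _⟩

theorem jet_add {φ ψ : α → ℝ} (hφ : IsTest O φ) (hψ : IsTest O ψ) :
    jet e (fun x => φ x + ψ x) = fun i x => jet e φ i x + jet e ψ i x := by
  funext i
  refine Fin.cases rfl (fun i => ?_) i
  funext x
  simp only [jet_succ]
  rw [fderiv_fun_add (hφ.differentiable x) (hψ.differentiable x)]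
  rfl

theorem jet_const_mul {φ : α → ℝ} (hφ : IsTest O φ) (c : ℝ) :
    jet e (fun x => c * φ x) = fun i x => c * jet e φ i x := by
  funext i
  refine Fin.cases rfl (fun i => ?_) i
  funext x
  simp only [jet_succ]
  rw [fderiv_const_mul (hφ.differentiable x)]
  rfl

variable [MeasureSpace α]

/-- With both integrals on one side, the weak derivative identity says that the swapped tuple
annihilates jets, so results on annihilators also apply to weak gradients. -/
theorem hasWeakDeriv_iff {i : Fin N} {U : Fin (N + 1) → α → ℝ} :
    HasWeakDeriv O (e i) (U 0) (U i.succ) ↔ LocallyIntegrableOn (U 0) O ∧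
      LocallyIntegrableOn (U i.succ) O ∧
      ∀ φ, IsTest O φ → pairing O (jet e φ) (swapAt i U) = 0 := by
  unfold HasWeakDeriv
  refine and_congr_right fun _ => and_congr_right fun _ => forall₂_congr fun φ _ => ?_
  rw [pairing_swapAt, eq_neg_iff_add_eq_zero, add_comm]
  simp only [jet_zero, jet_succ, mul_comm]

variable [BorelSpace α] {M M' : α → ℝ≥0 → ℝ≥0}

theorem IsTest.memE_jet (h : IsPhi O M) (hM : IsLocInt O M) {φ : α → ℝ} (hφ : IsTest O φ)
    (e : Fin N → α) (i : Fin (N + 1)) : MemE O M (jet e φ i) := by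
  obtain ⟨c, hc⟩ := hφ.exists_bound_jet e i
  exact h.memE_of_bounded hM (hφ.continuous_jet e i).aemeasurable hc hφ.2.1 hφ.2.2
    fun x hx => jet_eq_zero hx e i

/-- A tuple lies in the weak closure of the test functions if and only if it is annihilated by
everything in `Π E_{M'}` that annihilates the test functions. -/
theorem mem_closure_testFunctions_iff (h : IsComplementaryPair O M M') (hM : IsLocInt O M)
    {U : ProdL O M N} :
    U ∈ closure[weakStar O M M' N] (testFunctions O M e) ↔
      ∀ w : Fin (N + 1) → α → ℝ, (∀ i, MemE O M' (w i)) →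
        (∀ φ, IsTest O φ → pairing O (jet e φ) w = 0) → pairing O U.1 w = 0 := by
  constructor
  · intro hU w hw hφ
    let _ := weakStar O M M' N
    have hc : Continuous fun U : ProdL O M N => pairing O U.1 w :=
      (continuous_apply (⟨w, hw⟩ : ProdE O M' N)).comp
        (continuous_induced_dom (f := fun (U : ProdL O M N) (w : ProdE O M' N) =>
          ∑ i, ∫ x in O, U.1 i x * w.1 i x))
    have hcl : IsClosed {U : ProdL O M N | pairing O U.1 w = 0} :=
      isClosed_singleton.preimage hc
    refine closure_minimal (fun V hV => ?_) hcl hU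
    have hV2 : V.1 = jet e (V.1 0) := by
      funext i
      exact Fin.cases rfl (fun i => hV.2 i) i
    change pairing O V.1 w = 0
    rw [hV2]
    exact hφ _ hV.1
  · intro hU
    have hint : ∀ (U : ProdL O M N) (w : ProdE O M' N) i,
        IntegrableOn (fun x => U.1 i x * w.1 i x) O :=
      fun U w i => h.integrable_mul (U.2 i) (w.2 i)
    have hintφ : ∀ φ, IsTest O φ → ∀ (w : ProdE O M' N) i,
        IntegrableOn (fun x => jet e φ i x * w.1 i x) O :=
      fun φ hφ w i => h.integrable_mul (hφ.memE_jet h.left hM e i).memL (w.2 i)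
    let S : Submodule ℝ (ProdE O M' N → ℝ) :=
      { carrier := {y | ∃ φ, IsTest O φ ∧ y = fun w => pairing O (jet e φ) w.1}
        add_mem' := by
          rintro _ _ ⟨φ, hφ, rfl⟩ ⟨ψ, hψ, rfl⟩
          refine ⟨_, hφ.add hψ, funext fun w => ?_⟩
          rw [jet_add hφ hψ, pairing_add_left (hintφ φ hφ w) (hintφ ψ hψ w)]
          rfl
        zero_mem' := by
          refine ⟨_, isTest_zero, funext fun w => ?_⟩
          have := jet_const_mul (e := e) (isTest_zero (O := O)) 0
          simp only [zero_mul] at this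
          simp [this, pairing]
        smul_mem' := by
          rintro c _ ⟨φ, hφ, rfl⟩
          refine ⟨_, hφ.const_mul c, funext fun w => ?_⟩
          rw [jet_const_mul hφ, pairing_const_mul_left]
          rfl }
    rw [closure_induced]
    refine closure_mono (s := (S : Set (ProdE O M' N → ℝ))) ?_
      (mem_closure_of_forall_sum_eq_zero S _ fun s c hc => ?_)
    · rintro _ ⟨φ, hφ, rfl⟩
      exact ⟨⟨jet e φ, fun i => (hφ.memE_jet h.left hM e i).memL⟩, ⟨hφ, fun i => rfl⟩, rfl⟩
    · change ∑ w ∈ s, c w * pairing O U.1 w.1 = 0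
      rw [← pairing_sum_right s c fun w _ i => hint U w i]
      -- A finite combination of pairings is the pairing with one combined tuple, again in `Π
      -- E_{M'}`.
      refine hU _ (fun i => h.right.memE_sum s fun w _ => h.right.memE_const_mul (w.2 i) (c w)) ?_
      intro φ hφ
      rw [pairing_sum_right s c fun w _ i => hintφ φ hφ w i]
      exact hc _ ⟨φ, hφ, rfl⟩

variable [FiniteDimensional ℝ α] [(volume : Measure α).IsAddHaarMeasure]

theorem pairing_jet_swapAt_jet {φ ψ : α → ℝ} (hφ : IsTest O φ) (hψ : IsTest O ψ) (i : Fin N) :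
    pairing O (jet e φ) (swapAt i (jet e ψ)) = 0 := by
  rw [pairing_swapAt, ← eq_neg_iff_add_eq_zero]
  have hφ0 : ∀ x ∉ O, φ x = 0 := fun x hx =>
    image_eq_zero_of_notMem_tsupport fun h => hx (hφ.2.2 h)
  have hψ0 : ∀ x ∉ O, ψ x = 0 := fun x hx =>
    image_eq_zero_of_notMem_tsupport fun h => hx (hψ.2.2 h)
  have hint : ∀ i j, Integrable fun x => jet e φ i x * jet e ψ j x := fun i j =>
    ((hφ.continuous_jet e i).mul (hψ.continuous_jet e j)).integrable_of_hasCompactSupport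
      (hφ.hasCompactSupport_jet e i).mul_right
  simp only [jet_zero, jet_succ]
  rw [setIntegral_eq_integral_of_forall_compl_eq_zero fun x hx => by rw [hφ0 x hx, zero_mul],
    setIntegral_eq_integral_of_forall_compl_eq_zero fun x hx => by rw [hψ0 x hx, mul_zero]]
  exact integral_mul_fderiv_eq_neg_fderiv_mul_of_integrable (hint i.succ 0) (hint 0 i.succ)
    (hint 0 0) (fun x _ => hφ.differentiable x) (fun x _ => hψ.differentiable x)

/-- The defect of integration by parts against a fixed `φ` is the pairing with the swapped jet of
`φ`. That tuple lies in `Π E_{M'}` and annihilates test functions, hence also their closure. -/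
theorem closure_testFunctions_subset_sobolev (h : IsComplementaryPair O M M') (hO : IsOpen O)
    (hM : IsLocInt O M) (hM' : IsLocInt O M') :
    closure[weakStar O M M' N] (testFunctions O M e) ⊆ sobolev O M e := by
  intro U hU i
  rw [hasWeakDeriv_iff]
  refine ⟨h.locallyIntegrableOn_left hO hM' (U.2 _), h.locallyIntegrableOn_left hO hM' (U.2 _),
    fun φ hφ => ?_⟩
  have hswap : pairing O (jet e φ) (swapAt i U.1) = pairing O U.1 (swapAt i (jet e φ)) := by
    rw [pairing_swapAt, pairing_swapAt, add_comm]
    simp only [mul_comm]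
  rw [hswap]
  refine (mem_closure_testFunctions_iff h hM).1 hU _ (fun j => ?_)
    (fun ψ hψ => pairing_jet_swapAt_jet hψ hφ i)
  refine Fin.cases (hφ.memE_jet h.right hM' e i.succ) (fun j => ?_) j
  rcases eq_or_ne j i with rfl | hj
  · simpa [swapAt] using hφ.memE_jet h.right hM' e 0
  · have h0 : MemE O M' (0 : α → ℝ) := h.right.memE_zero
    simpa [swapAt, hj] using h0

end Test

/-! ### Measurable selection from Souslin schemes -/

section Selection

theorem map_range_succ_eq_append {β : Type*} (f : ℕ → β) (k : ℕ) :
    (List.range (k + 1)).map f = (List.range k).map f ++ [f k] := by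
  rw [List.range_succ, List.map_append, List.map_singleton]

/-- A tree of measurable sets without dead ends has a measurable branch. -/
theorem exists_measurable_branch {α : Type*} [MeasurableSpace α] {A : List ℕ → Set α}
    (hA : ∀ l, MeasurableSet (A l)) (h : ∀ l, ∀ t ∈ A l, ∃ v, t ∈ A (l ++ [v])) :
    ∃ σ : ℕ → α → ℕ, (∀ k, Measurable (σ k)) ∧
      ∀ t ∈ A [], ∀ k, t ∈ A ((List.range k).map fun i => σ i t) := by
  classical
  let _ : MeasurableSpace (List ℕ) := ⊤
  have : DiscreteMeasurableSpace (List ℕ) := ⟨fun _ => trivial⟩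
  let F : α × List ℕ → ℕ := fun p => sInf {v | p.1 ∈ A (p.2 ++ [v])}
  have hF : Measurable F := by
    refine measurable_from_prod_countable_left fun l => ?_
    refine measurable_to_countable' fun n => ?_
    -- Since `sInf ∅ = 0`, points without a continuation of `l` are added to the fibre over `0`.
    have : (fun t => F (t, l)) ⁻¹' {n} =
        (A (l ++ [n]) \ ⋃ m ∈ {m | m < n}, A (l ++ [m])) ∪
          (if n = 0 then (⋃ m, A (l ++ [m]))ᶜ else ∅) := by
      ext t
      simp only [F, mem_preimage, mem_singleton_iff, mem_union, Set.mem_sdiff, mem_iUnion,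
        mem_ofPred_eq,
        exists_prop, not_exists, not_and]
      rcases eq_empty_or_nonempty {v | t ∈ A (l ++ [v])} with he | hne
      · have he' : ∀ v, t ∉ A (l ++ [v]) := fun v hv => by
          have : v ∈ {v | t ∈ A (l ++ [v])} := hv
          rw [he] at this; exact this
        rw [he, Nat.sInf_empty]
        split_ifs with hn
        · simp [he', hn]
        · simp [he', Ne.symm hn]
      · have hmem := Nat.sInf_mem hne
        have h0 : t ∉ (if n = 0 then (⋃ m, A (l ++ [m]))ᶜ else ∅) := by
          split_ifs
          · simp only [mem_compl_iff, mem_iUnion, not_not]; exact ⟨_, hmem⟩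
          · simp
        simp only [h0, or_false]
        constructor
        · rintro rfl
          exact ⟨hmem, fun m hm hm' => absurd (Nat.sInf_le (s := {v | t ∈ A (l ++ [v])}) hm')
            (not_le.2 hm)⟩
        · rintro ⟨h1, h2⟩
          refine le_antisymm (Nat.sInf_le h1) (not_lt.1 fun h3 => h2 _ h3 hmem)
    rw [this]
    refine ((hA _).diff (MeasurableSet.biUnion (to_countable _) fun _ _ => hA _)).union ?_
    split_ifs
    · exact (MeasurableSet.iUnion fun _ => hA _).compl
    · exact MeasurableSet.empty
  let sel : ℕ → α → List ℕ := fun k => Nat.rec (fun _ => []) (fun _ s t => s t ++ [F (t, s t)]) k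
  have hsucc : ∀ k t, sel (k + 1) t = sel k t ++ [F (t, sel k t)] := fun _ _ => rfl
  have hsel : ∀ k, Measurable (sel k) := by
    intro k
    induction k with
    | zero => exact measurable_const
    | succ k ih =>
      have : sel (k + 1) = (fun p : List ℕ × ℕ => p.1 ++ [p.2]) ∘
        fun t => (sel k t, F (t, sel k t)) := by
        funext t; exact hsucc k t
      rw [this]
      exact (Measurable.of_discrete (f := fun p : List ℕ × ℕ => p.1 ++ [p.2])).comp
        (ih.prodMk (hF.comp (measurable_id.prodMk ih)))
  refine ⟨fun k t => F (t, sel k t), fun k => hF.comp (measurable_id.prodMk (hsel k)), ?_⟩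
  intro t ht k
  have hmap : ∀ k, (List.range k).map (fun i => F (t, sel i t)) = sel k t := by
    intro k
    induction k with
    | zero => rfl
    | succ k ih => rw [map_range_succ_eq_append, ih, hsucc]
  rw [hmap]
  induction k with
  | zero => exact ht
  | succ k ih =>
    rw [hsucc]
    exact Nat.sInf_mem (s := {v | t ∈ A (sel k t ++ [v])}) (h _ t ih)

theorem exists_branch {p : List ℕ → Prop} (h0 : p []) (h : ∀ l, p l → ∃ v, p (l ++ [v])) :
    ∃ σ : ℕ → ℕ, ∀ k, p ((List.range k).map σ) := by
  let _ : MeasurableSpace Unit := ⊤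
  obtain ⟨σ, -, hσ⟩ := exists_measurable_branch (A := fun l => {_t : Unit | p l})
    (fun _ => trivial) (fun l t ht => h l ht)
  exact ⟨fun k => σ k (), hσ () h0⟩

/-- Measurable selection of a bounded branch from a Souslin scheme, on a set of positive measure. -/
theorem exists_selection_of_measurable {α : Type*} [MeasurableSpace α] {μ : Measure α}
    [IsFiniteMeasure μ] {P : List ℕ → Set α} (hP : ∀ l, MeasurableSet (P l)) {B : Set α}
    (hB : ∀ t ∈ B, ∃ σ : ℕ → ℕ, ∀ k, t ∈ P ((List.range k).map σ)) (hμ : 0 < μ B) :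
    ∃ (n : ℕ → ℕ) (S : Set α) (σ : ℕ → α → ℕ), MeasurableSet S ∧ 0 < μ S ∧
      (∀ k, Measurable (σ k)) ∧
      ∀ t ∈ S, ∀ k, σ k t ≤ n k ∧ t ∈ P ((List.range k).map fun i => σ i t) := by
  obtain ⟨δ, hδ0, hδ⟩ := exists_between hμ
  -- the part of `B` with a branch bounded by the word `l`
  let C : List ℕ → Set α := fun l => {t | ∃ σ : ℕ → ℕ, (∀ k, t ∈ P ((List.range k).map σ)) ∧
    ∀ i (hi : i < l.length), σ i ≤ l[i]}
  -- The sets `C l` need not be measurable. Raising the bound on the next index exhausts `C l`, and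
  -- outer measure is continuous along increasing unions, so some bound keeps it above `δ`.
  obtain ⟨n, hn⟩ : ∃ n : ℕ → ℕ, ∀ k, δ < μ (C ((List.range k).map n)) := by
    refine exists_branch (p := fun l => δ < μ (C l)) ?_ ?_
    · refine hδ.trans_le (measure_mono fun t ht => ?_)
      obtain ⟨σ, hσ⟩ := hB t ht
      exact ⟨σ, hσ, fun i hi => absurd hi (by simp)⟩
    · intro l hl
      have hmono : Monotone fun v => C (l ++ [v]) := by
        intro v w hvw t
        rintro ⟨σ, h1, h2⟩
        refine ⟨σ, h1, fun i hi => ?_⟩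
        have := h2 i (by simpa using hi)
        rw [List.getElem_append] at this ⊢
        split_ifs at this ⊢
        · exact this
        · simp only [List.getElem_singleton] at this ⊢; exact this.trans hvw
      have hsub : C l ⊆ ⋃ v, C (l ++ [v]) := by
        rintro t ⟨σ, h1, h2⟩
        refine mem_iUnion.2 ⟨σ l.length, σ, h1, fun i hi => ?_⟩
        rw [List.getElem_append]
        split_ifs with h
        · exact h2 i h
        · simp only [List.length_append, List.length_singleton] at hi
          have : i = l.length := by omega
          simp [this]
      have := hl.trans_le (measure_mono hsub)
      rw [hmono.measure_iUnion] at this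
      exact lt_iSup_iff.1 this
  -- words that can be continued to bounded words of every length
  let bdd : List ℕ → Prop := fun l => ∀ i (hi : i < l.length), l[i] ≤ n i
  let good : List ℕ → Set α := fun l => ⋂ j ∈ {j | j ≤ l.length}, P (l.take j)
  let A : List ℕ → Set α := fun l => ⋂ m : ℕ, ⋃ l' ∈ {l' : List ℕ | bdd (l ++ l') ∧ l'.length = m},
    good (l ++ l')
  have hgood : ∀ l, MeasurableSet (good l) := fun l =>
    MeasurableSet.biInter (to_countable _) fun _ _ => hP _
  have hA : ∀ l, MeasurableSet (A l) := fun l => MeasurableSet.iInter fun m =>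
    MeasurableSet.biUnion (to_countable _) fun _ _ => hgood _
  have hmemA : ∀ l t, t ∈ A l ↔ ∀ m, ∃ l', bdd (l ++ l') ∧ l'.length = m ∧ t ∈ good (l ++ l') := by
    intro l t
    simp [A, and_assoc]
  have hgood_pre : ∀ l l' t, t ∈ good (l ++ l') → t ∈ good l := by
    intro l l' t ht
    simp only [good, mem_ofPred_eq, mem_iInter] at ht ⊢
    intro j hj
    have := ht j (by simp; omega)
    rwa [List.take_append_of_le_length hj] at this
  have hbdd_pre : ∀ l l', bdd (l ++ l') → bdd l := by
    intro l l' h i hi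
    have := h i (by simp; omega)
    rwa [List.getElem_append_left hi] at this
  -- König's lemma: only finitely many `v` are below the bound. If each one failed at some length `m
  -- v`, it would fail at all greater lengths, contradicting a bounded extension of `l` longer than
  -- `∑ m v`.
  have hstep : ∀ l, ∀ t ∈ A l, ∃ v, t ∈ A (l ++ [v]) := by
    intro l t ht
    rw [hmemA] at ht
    by_contra hcon
    push Not at hcon
    simp only [hmemA] at hcon
    push Not at hcon
    choose m hm using hcon
    let m' := ∑ v ∈ Finset.range (n l.length + 1), m v
    obtain ⟨l', h1, h2, h3⟩ := ht (m' + 1)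
    cases l' with
    | nil => simp at h2
    | cons v l'' =>
      have e : l ++ v :: l'' = (l ++ [v]) ++ l'' := by simp
      have hv : v ≤ n l.length := by
        have := h1 l.length (by simp)
        simpa using this
      have hmv : m v ≤ l''.length := by
        have h4 : m v ≤ m' := Finset.single_le_sum (f := m) (fun _ _ => Nat.zero_le _)
          (Finset.mem_range.2 (Nat.lt_succ_of_le hv))
        simp at h2
        omega
      have e2 : l ++ v :: l'' = ((l ++ [v]) ++ l''.take (m v)) ++ l''.drop (m v) := by simp
      rw [e2] at h1 h3
      exact hm v _ (hbdd_pre _ _ h1) (by simp [hmv]) (hgood_pre _ _ _ h3)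
  obtain ⟨σ, hσm, hσ⟩ := exists_measurable_branch hA hstep
  refine ⟨n, A [], σ, hA _, ?_, hσm, ?_⟩
  -- `A []` is a decreasing intersection of measurable sets, the `m`-th of which contains `C` of the
  -- first `m` bounds; its measure is thus at least `δ`.
  · have hanti : Antitone fun m => ⋃ l' ∈ {l' : List ℕ | bdd ([] ++ l') ∧ l'.length = m},
        good ([] ++ l') := by
      intro m m' hmm t
      simp only [List.nil_append, mem_ofPred_eq, mem_iUnion, exists_prop]
      rintro ⟨l', ⟨h1, h2⟩, h3⟩
      rw [← List.take_append_drop m l'] at h1 h3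
      exact ⟨l'.take m, ⟨hbdd_pre _ _ h1, by simp; omega⟩, hgood_pre _ _ _ h3⟩
    have hlim := tendsto_measure_iInter_atTop (μ := μ)
      (fun m => (MeasurableSet.biUnion (to_countable {l' : List ℕ | bdd ([] ++ l') ∧ l'.length = m})
        fun l' _ => hgood ([] ++ l')).nullMeasurableSet) hanti ⟨0, measure_ne_top _ _⟩
    refine hδ0.trans_le (ge_of_tendsto' hlim fun m => (hn m).le.trans (measure_mono ?_))
    rintro t ⟨ρ, h1, h2⟩
    simp only [List.nil_append, mem_ofPred_eq, mem_iUnion, exists_prop]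
    refine ⟨(List.range m).map ρ, ⟨fun i hi => ?_, by simp⟩, ?_⟩
    · have := h2 i (by simpa using hi)
      simpa using this
    · simp only [good, mem_ofPred_eq, mem_iInter]
      intro j hj
      rw [← List.map_take, List.take_range]
      exact h1 _
  · intro t ht k
    have key : ∀ k, bdd ((List.range k).map fun i => σ i t) ∧
        t ∈ good ((List.range k).map fun i => σ i t) := by
      intro k
      obtain ⟨l', h1, h2, h3⟩ := (hmemA _ _).1 (hσ t ht k) 0
      rw [List.length_eq_zero_iff] at h2
      subst h2
      simpa using And.intro h1 h3
    constructor
    · have := (key (k + 1)).1 k (by simp)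
      simpa using this
    · have := (key k).2
      simp only [good, mem_ofPred_eq, mem_iInter] at this
      have h5 := this k (by simp)
      rwa [List.take_of_length_le (by simp)] at h5

/-- Each `P l` contains a measurable set of full measure in it; the countably many differences form
one null set, which is removed from `B`. -/
theorem exists_selection {α : Type*} [MeasurableSpace α] {μ : Measure α}
    [IsFiniteMeasure μ] {P : List ℕ → Set α} (hP : ∀ l, NullMeasurableSet (P l) μ) {B : Set α}
    (hB : ∀ t ∈ B, ∃ σ : ℕ → ℕ, ∀ k, t ∈ P ((List.range k).map σ)) (hμ : 0 < μ B) :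
    ∃ (n : ℕ → ℕ) (S : Set α) (σ : ℕ → α → ℕ), MeasurableSet S ∧ 0 < μ S ∧
      (∀ k, Measurable (σ k)) ∧
      ∀ t ∈ S, ∀ k, σ k t ≤ n k ∧ t ∈ P ((List.range k).map fun i => σ i t) := by
  choose Q hQP hQ hQe using fun l => (hP l).exists_measurable_subset_ae_eq
  have hnull : μ (⋃ l, P l \ Q l) = 0 := by
    refine measure_iUnion_null fun l => ?_
    exact (ae_le_set.1 (hQe l).symm.le)
  obtain ⟨n, S, σ, h1, h2, h3, h4⟩ := exists_selection_of_measurable hQ (μ := μ)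
    (B := B \ ⋃ l, P l \ Q l) (fun t ht => by
      obtain ⟨σ, hσ⟩ := hB t ht.1
      refine ⟨σ, fun k => ?_⟩
      by_contra hk
      exact ht.2 (mem_iUnion.2 ⟨_, hσ k, hk⟩)) (by rwa [measure_sdiff_null hnull])
  exact ⟨n, S, σ, h1, h2, h3, fun t ht k => ⟨(h4 t ht k).1, hQP _ (h4 t ht k).2⟩⟩

end Selection

/-! ### Compact exhaustions, truncation and countable families -/

theorem exists_compact_exhaustion {α : Type*} [TopologicalSpace α] [LocallyCompactSpace α]
    [SecondCountableTopology α] {O : Set α} (hO : IsOpen O) :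
    ∃ K : ℕ → Set α, (∀ n, IsCompact (K n)) ∧ (∀ n, K n ⊆ O) ∧ Monotone K ∧
      ∀ C, IsCompact C → C ⊆ O → ∃ n, C ⊆ K n := by
  have : LocallyCompactSpace O := hO.locallyCompactSpace
  let E : CompactExhaustion O := default
  refine ⟨fun n => Subtype.val '' E n, fun n => (E.isCompact n).image continuous_subtype_val,
    fun n => by rintro _ ⟨x, -, rfl⟩; exact x.2,
    fun m n hmn => image_mono (E.subset hmn), fun C hC hCO => ?_⟩
  have hC' : IsCompact (Subtype.val ⁻¹' C : Set O) := by
    rw [Subtype.isCompact_iff, Subtype.image_preimage_coe, inter_eq_right.2 hCO]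
    exact hC
  obtain ⟨n, hn⟩ := E.exists_superset_of_isCompact hC'
  refine ⟨n, fun x hx => ⟨⟨x, hCO hx⟩, hn hx, rfl⟩⟩

/-- Truncation of a real number to `[-c, c]`. -/
def truncate (c : ℝ≥0) (r : ℝ) : ℝ := max (-c) (min r c)

theorem measurable_truncate (c : ℝ≥0) : Measurable (truncate c) :=
  measurable_const.max (measurable_id.min measurable_const)

theorem continuous_truncate (c : ℝ≥0) : Continuous (truncate c) :=
  continuous_const.max (continuous_id.min continuous_const)

theorem abs_truncate_le (c : ℝ≥0) (r : ℝ) : |truncate c r| ≤ c := by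
  have := c.2
  rw [abs_le]
  exact ⟨le_max_left _ _, max_le (by linarith [c.coe_nonneg]) (min_le_right _ _)⟩

theorem truncate_of_abs_le {c : ℝ≥0} {r : ℝ} (h : |r| ≤ c) : truncate c r = r := by
  rw [abs_le] at h
  rw [truncate, min_eq_left h.2, max_eq_right h.1]

theorem abs_sub_truncate_le (c : ℝ≥0) (r : ℝ) : |r - truncate c r| ≤ |r| := by
  have hc := c.coe_nonneg
  rcases le_total |r| c with h | h
  · rw [truncate_of_abs_le h]; simp
  · unfold truncate
    rcases le_total 0 r with h0 | h0
    · rw [abs_of_nonneg h0] at h ⊢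
      rw [min_eq_right h, max_eq_right (by linarith), abs_of_nonneg (by linarith)]
      linarith
    · rw [abs_of_nonpos h0] at h ⊢
      rw [min_eq_left (by linarith), max_eq_left (by linarith), abs_of_nonpos (by linarith)]
      linarith

theorem tendsto_modular_of_dominated {α : Type*} [MeasureSpace α] {O : Set α}
    {M : α → ℝ≥0 → ℝ≥0} (h : IsPhi O M) {l : ℝ≥0} {u : ℕ → α → ℝ} (hu : ∀ n, AEMeasurable (u n) (volume.restrict O)) {g : α → ℝ≥0∞}
    (hg : ∫⁻ x in O, g x ≠ ⊤)
    (hb : ∀ n, ∀ᵐ x ∂volume.restrict O, (M x (‖u n x‖₊ / l) : ℝ≥0∞) ≤ g x)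
    (hlim : ∀ᵐ x ∂volume.restrict O, Tendsto (fun n => u n x) atTop (𝓝 0)) :
    Tendsto (fun n => modular O M l (u n)) atTop (𝓝 0) := by
  have h0 : (0 : ℝ≥0∞) = ∫⁻ _ in O, 0 := by simp
  rw [h0]
  refine tendsto_lintegral_of_dominated_convergence' g (fun n => h.aemeasurable_comp (hu n) l) hb hg
    ?_
  filter_upwards [hlim, h.ae_continuous, h.ae_zero] with x h1 h2 h3
  have h4 : Tendsto (fun n => ‖u n x‖₊ / l) atTop (𝓝 0) := by
    simpa using h1.nnnorm.div_const l
  have h5 := (h2.tendsto 0).comp h4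
  rw [h3] at h5
  exact ENNReal.tendsto_coe.2 h5

section

variable {α : Type*} [NormedAddCommGroup α] [NormedSpace ℝ α] [FiniteDimensional ℝ α]
  [MeasureSpace α] [BorelSpace α] {O : Set α} {N : ℕ} {e : Fin N → α}

/-- Countably many test functions suffice to detect the annihilator of all test functions. -/
theorem exists_countable_test (hO : IsOpen O) (e : Fin N → α) :
    ∃ D : ℕ → α → ℝ, (∀ n, IsTest O (D n)) ∧ ∀ v : Fin (N + 1) → α → ℝ,
      (∀ i, LocallyIntegrableOn (v i) O) → (∀ n, pairing O (jet e (D n)) v = 0) →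
      ∀ φ, IsTest O φ → pairing O (jet e φ) v = 0 := by
  have : ProperSpace α := FiniteDimensional.proper ℝ α
  obtain ⟨K, hK, hKO, -, hKs⟩ := exists_compact_exhaustion hO
  -- Jets are regarded as points of a second countable space, continuous maps with the compact-open
  -- topology, so those supported in `K m` have a countable dense subset.
  let F : {φ : α → ℝ // IsTest O φ} → C(α, Fin (N + 1) → ℝ) := fun φ =>
    ⟨fun x i => jet e φ.1 i x, continuous_pi fun i => φ.2.continuous_jet e i⟩
  let S : ℕ → Set C(α, Fin (N + 1) → ℝ) := fun m => F '' {φ | tsupport φ.1 ⊆ K m}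
  have hne : ∀ m, Nonempty (S m) := fun m =>
    ⟨⟨_, ⟨⟨fun _ => 0, isTest_zero⟩, by
      have : tsupport (fun _ : α => (0 : ℝ)) = ∅ := tsupport_eq_empty_iff.2 rfl
      simp [this], rfl⟩⟩⟩
  let s : ∀ m, ℕ → S m := fun m => TopologicalSpace.denseSeq (S m)
  choose φ hφK hφs using fun m j => (s m j).2
  refine ⟨fun p => (φ p.unpair.1 p.unpair.2).1, fun p => (φ p.unpair.1 p.unpair.2).2,
    fun v hv hD ψ hψ => ?_⟩
  obtain ⟨m, hm⟩ := hKs _ hψ.2.1 hψ.2.2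
  have hcl : (⟨F ⟨ψ, hψ⟩, ⟨ψ, hψ⟩, hm, rfl⟩ : S m) ∈ closure (range (s m)) :=
    TopologicalSpace.denseRange_denseSeq (S m) _
  rw [mem_closure_iff_seq_limit] at hcl
  obtain ⟨y, hy, hyt⟩ := hcl
  choose j hj using hy
  have hyt' : Tendsto (fun n => F (φ m (j n))) atTop (𝓝 (F ⟨ψ, hψ⟩)) := by
    have := (continuous_subtype_val.tendsto _).comp hyt
    refine this.congr fun n => ?_
    simp only [Function.comp_apply, ← hj]
    exact (hφs m (j n)).symm
  have hunif := ContinuousMap.tendsto_iff_forall_isCompact_tendstoUniformlyOn.1 hyt' (K m) (hK m)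
  have hlim : Tendsto (fun n => pairing O (jet e (φ m (j n)).1) v) atTop
      (𝓝 (pairing O (jet e ψ) v)) := by
    unfold pairing
    refine tendsto_finsetSum _ fun i _ => ?_
    have hres : ∀ χ : α → ℝ, tsupport χ ⊆ K m →
        ∫ x in O, jet e χ i x * v i x = ∫ x in K m, jet e χ i x * v i x := by
      intro χ hχ
      refine setIntegral_eq_of_subset_of_forall_sdiff_eq_zero hO.measurableSet (hKO m) fun x hx => ?_
      rw [jet_eq_zero (fun h => hx.2 (hχ h)), zero_mul]
    rw [hres ψ hm]
    simp_rw [fun n => hres (φ m (j n)).1 (hφK m (j n))]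
    have hvi : IntegrableOn (v i) (K m) :=
      (hv i).integrableOn_compact_subset (hKO m) (hK m)
    obtain ⟨c, hc⟩ := hψ.exists_bound_jet e i
    have hpt : ∀ x ∈ K m, ∀ ε > 0, ∀ᶠ n in atTop,
        dist (jet e ψ i x) (jet e (φ m (j n)).1 i x) < ε := by
      intro x hx ε hε
      filter_upwards [Metric.tendstoUniformlyOn_iff.1 hunif ε hε] with n hn
      exact (dist_le_pi_dist _ _ i).trans_lt (hn x hx)
    refine tendsto_integral_filter_of_dominated_convergence (fun x => ((c : ℝ) + 1) * ‖v i x‖)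
      (Eventually.of_forall fun n =>
        ((φ m (j n)).2.continuous_jet e i).aestronglyMeasurable.mul hvi.1) ?_
      (hvi.norm.const_mul _) ?_
    · filter_upwards [Metric.tendstoUniformlyOn_iff.1 hunif 1 one_pos] with n hn
      filter_upwards [ae_restrict_mem (hK m).measurableSet] with x hx
      rw [norm_mul]
      gcongr
      have h1 : dist (jet e ψ i x) (jet e (φ m (j n)).1 i x) < 1 :=
        (dist_le_pi_dist _ _ i).trans_lt (hn x hx)
      have h2 : ‖jet e ψ i x‖ ≤ c := hc x
      rw [dist_comm, dist_eq_norm] at h1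
      have h3 := norm_le_norm_add_norm_sub (jet e ψ i x) (jet e (φ m (j n)).1 i x)
      rw [norm_sub_rev] at h3
      linarith
    · filter_upwards [ae_restrict_mem (hK m).measurableSet] with x hx
      refine Tendsto.mul_const _ ?_
      rw [Metric.tendsto_nhds]
      intro ε hε
      simpa only [dist_comm] using hpt x hx ε hε
  have hz : ∀ n, pairing O (jet e (φ m (j n)).1) v = 0 := by
    intro n
    have := hD (Nat.pair m (j n))
    simpa using this
  simp only [hz] at hlim
  exact (tendsto_nhds_unique hlim tendsto_const_nhds)

/-- There is a countable family of bounded functions with compact support that is modularly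
dense in every space `E_M`. -/
theorem exists_countable_dense (hO : IsOpen O) [IsFiniteMeasureOnCompacts (volume : Measure α)] :
    ∃ d : ℕ → α → ℝ, (∀ n, Measurable (d n)) ∧ (∀ n, ∃ c : ℝ≥0, ∀ x, ‖d n x‖₊ ≤ c) ∧
      (∀ n, ∃ K, IsCompact K ∧ K ⊆ O ∧ ∀ x ∉ K, d n x = 0) ∧
      ∀ M : α → ℝ≥0 → ℝ≥0, IsPhi O M → IsLocInt O M → ∀ v, MemE O M v →
        ∀ l : ℝ≥0, 0 < l → ∀ ε : ℝ≥0∞, ε ≠ 0 →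
          ∃ n, modular O M l (fun x => v x - d n x) < ε := by
  have : ProperSpace α := FiniteDimensional.proper ℝ α
  have : Fact ((1 : ℝ≥0∞) ≠ ⊤) := ⟨ENNReal.one_ne_top⟩
  obtain ⟨K, hK, hKO, hKm, hKs⟩ := exists_compact_exhaustion hO
  -- A dense sequence of `L¹` is cut off at height `m` and to `K m`. It does not depend on `M`, so
  -- it will serve all slices `M (t, ·)` at once.
  let E : ℕ → Lp ℝ 1 (volume : Measure α) := TopologicalSpace.denseSeq _
  have hE : DenseRange E := TopologicalSpace.denseRange_denseSeq _
  let d : ℕ → ℕ → α → ℝ := fun m j => (K m).indicator fun x => truncate m (E j x)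
  have hdm : ∀ m j, Measurable (d m j) := fun m j =>
    ((measurable_truncate _).comp (Lp.stronglyMeasurable _).measurable).indicator
      (hK m).measurableSet
  have hdb : ∀ m j x, |d m j x| ≤ (m : ℝ≥0) := by
    intro m j x
    by_cases hx : x ∈ K m
    · simp only [d, indicator_of_mem hx]; exact abs_truncate_le _ _
    · simp [d, indicator_of_notMem hx]
  refine ⟨fun p => d p.unpair.1 p.unpair.2, fun p => hdm _ _,
    fun p => ⟨p.unpair.1, fun x => hdb _ _ x⟩,
    fun p => ⟨K p.unpair.1, hK _, hKO _, fun x hx => indicator_of_notMem hx _⟩, ?_⟩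
  intro M h hM v hv l hl ε hε
  have hl2 : 0 < l / 2 := by positivity
  -- truncation
  let V : ℕ → α → ℝ := fun m => (K m).indicator fun x => truncate m (v x)
  have hVm : ∀ m, AEMeasurable (V m) (volume.restrict O) := fun m =>
    ((measurable_truncate _).comp_aemeasurable hv.1).indicator (hK m).measurableSet
  have hVb : ∀ m x, |V m x| ≤ (m : ℝ≥0) := by
    intro m x
    by_cases hx : x ∈ K m
    · simp only [V, indicator_of_mem hx]; exact abs_truncate_le _ _
    · simp [V, indicator_of_notMem hx]
  have h1 : Tendsto (fun m => modular O M (l / 2) fun x => v x - V m x) atTop (𝓝 0) := by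
    refine tendsto_modular_of_dominated h (fun m => hv.1.sub (hVm m)) (hv.2 _ hl2).ne (fun m => ?_)
      ?_
    · filter_upwards [h.ae_monotone] with x hx
      have : ‖v x - V m x‖₊ ≤ ‖v x‖₊ := by
        by_cases hxK : x ∈ K m
        · simp only [V, indicator_of_mem hxK]; exact abs_sub_truncate_le _ _
        · simp [V, indicator_of_notMem hxK]
      have := hx (a := ‖v x - V m x‖₊ / (l / 2)) (b := ‖v x‖₊ / (l / 2)) (by gcongr)
      exact_mod_cast this
    · filter_upwards [ae_restrict_mem hO.measurableSet] with x hx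
      obtain ⟨m₀, hm₀⟩ := hKs {x} isCompact_singleton (singleton_subset_iff.2 hx)
      obtain ⟨m₁, hm₁⟩ := exists_nat_ge |v x|
      refine tendsto_const_nhds.congr' ?_
      filter_upwards [eventually_ge_atTop (max m₀ m₁)] with m hm
      have hxm : x ∈ K m := hKm ((le_max_left _ _).trans hm) (hm₀ rfl)
      have hvm : |v x| ≤ (m : ℝ≥0) := by
        refine hm₁.trans ?_
        exact_mod_cast (le_max_right _ _).trans hm
      simp only [V, indicator_of_mem hxm, truncate_of_abs_le hvm, sub_self]
  obtain ⟨m, hm⟩ := (h1.eventually (gt_mem_nhds (pos_iff_ne_zero.2 hε))).exists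
  -- approximation of the truncated function
  have hVL : MemLp (V m) 1 volume := by
    rw [memLp_one_iff_integrable]
    refine IntegrableOn.integrable_indicator ?_ (hK m).measurableSet
    have : IsFiniteMeasure (volume.restrict (K m)) := ⟨by simpa using (hK m).measure_lt_top⟩
    exact Integrable.of_bound
      ((measurable_truncate _).comp_aemeasurable (hv.1.mono_set (hKO m))).aestronglyMeasurable m
      (Eventually.of_forall fun x => abs_truncate_le _ _)
  obtain ⟨y, hy, hyt⟩ := mem_closure_iff_seq_limit.1 (hE (hVL.toLp _))
  choose j hj using hy
  have hmeas : TendstoInMeasure volume (fun n => E (j n)) atTop (hVL.toLp _) := by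
    refine tendstoInMeasure_of_tendsto_Lp ?_
    simpa only [hj] using hyt
  obtain ⟨ns, -, hns⟩ := hmeas.exists_seq_tendsto_ae
  -- `L¹` convergence gives a.e. convergence along a subsequence; the common bound `m` and support
  -- `K m` give a dominating function through local integrability.
  have h2 : Tendsto (fun n => modular O M (l / 2) fun x => V m x - d m (j (ns n)) x) atTop (𝓝 0) := by
    refine tendsto_modular_of_dominated h
      (g := (K m).indicator fun x => (M x ((m + m + 1) / (l / 2)) : ℝ≥0∞))
      (fun n => (hVm m).sub (hdm _ _).aemeasurable) ?_ (fun n => ?_) ?_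
    · rw [lintegral_indicator (hK m).measurableSet, Measure.restrict_restrict (hK m).measurableSet,
        inter_eq_self_of_subset_left (hKO m)]
      exact (hM _ (by positivity) _ (hK m) (hKO m)).ne
    · filter_upwards [h.ae_monotone, h.ae_zero] with x hx hx0
      by_cases hxK : x ∈ K m
      · rw [indicator_of_mem hxK]
        have h3 : ‖V m x - d m (j (ns n)) x‖₊ ≤ m + m + 1 := by
          have h4 := (nnnorm_sub_le (V m x) (d m (j (ns n)) x)).trans
            (add_le_add (show ‖V m x‖₊ ≤ (m : ℝ≥0) from hVb m x)
              (show ‖d m (j (ns n)) x‖₊ ≤ (m : ℝ≥0) from hdb m _ x))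
          exact h4.trans (by simp)
        have := hx (a := ‖V m x - d m (j (ns n)) x‖₊ / (l / 2)) (b := (m + m + 1) / (l / 2))
          (by gcongr)
        exact_mod_cast this
      · simp [V, d, indicator_of_notMem hxK, hx0]
    · filter_upwards [ae_restrict_of_ae hns, ae_restrict_of_ae hVL.coeFn_toLp] with x hx hx2
      rw [hx2] at hx
      by_cases hxK : x ∈ K m
      · have h3 := ((continuous_truncate m).tendsto _).comp hx
        rw [truncate_of_abs_le (hVb m x)] at h3
        have h4 := h3.const_sub (V m x)
        rw [sub_self] at h4
        refine h4.congr fun n => ?_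
        simp [d, indicator_of_mem hxK]
      · simp [V, d, indicator_of_notMem hxK]
  obtain ⟨n, hn⟩ := (h2.eventually (gt_mem_nhds (pos_iff_ne_zero.2 hε))).exists
  refine ⟨Nat.pair m (j (ns n)), ?_⟩
  simp only [Nat.unpair_pair]
  refine (h.modular_half (v := fun x => v x - V m x) (w := fun x => V m x - d m (j (ns n)) x)
    (hv.1.sub (hVm m)) (Eventually.of_forall fun x => ?_)).trans_lt ?_
  · exact (by simpa using nnnorm_add_le (v x - V m x) (V m x - d m (j (ns n)) x))
  · calc _ < ε / 2 + ε / 2 := ENNReal.add_lt_add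
          (ENNReal.div_lt_div_right two_ne_zero ENNReal.ofNat_ne_top hm)
          (ENNReal.div_lt_div_right two_ne_zero ENNReal.ofNat_ne_top hn)
      _ = ε := ENNReal.add_halves ε

end

/-! ### Completeness of `E_M` under modular convergence -/

section Complete

variable {α : Type*} [MeasureSpace α] {O : Set α} {M : α → ℝ≥0 → ℝ≥0}

theorem modular_le_of_tendsto (h : IsPhi O M) {l : ℝ≥0} {u : α → ℝ} {w : ℕ → α → ℝ} {v : α → ℝ}
    (hu : AEMeasurable u (volume.restrict O)) (hw : ∀ n, AEMeasurable (w n) (volume.restrict O))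
    (hlim : ∀ᵐ x ∂volume.restrict O, Tendsto (fun n => w n x) atTop (𝓝 (v x))) {c : ℝ≥0∞}
    (hc : ∀ᶠ n in atTop, modular O M l (fun x => u x - w n x) ≤ c) :
    modular O M l (fun x => u x - v x) ≤ c := by
  calc modular O M l (fun x => u x - v x)
      = ∫⁻ x in O, liminf (fun n => (M x (‖u x - w n x‖₊ / l) : ℝ≥0∞)) atTop := by
        refine lintegral_congr_ae ?_
        filter_upwards [hlim, h.ae_continuous] with x h1 h2
        have h3 : Tendsto (fun n => ‖u x - w n x‖₊ / l) atTop (𝓝 (‖u x - v x‖₊ / l)) :=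
          (h1.const_sub (u x)).nnnorm.div_const l
        have h4 := (h2.tendsto _).comp h3
        exact (Tendsto.liminf_eq (ENNReal.tendsto_coe.2 h4)).symm
    _ ≤ liminf (fun n => modular O M l (fun x => u x - w n x)) atTop :=
        lintegral_liminf_le' fun n => h.aemeasurable_comp (hu.sub (hw n)) l
    _ ≤ c := by
        refine liminf_le_of_frequently_le' hc.frequently

/-- The modulars of consecutive differences are summable, so almost everywhere `M x (|w k - w (k+1)|
/ 2⁻ᵏ)` is eventually below `M x 1`, and monotonicity forces `|w k - w (k+1)| ≤ 2⁻ᵏ`. For membership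
in `E_M` at scale `l`, Fatou compares the limit with a `w k` such that `2⁻ᵏ < l / 2`. -/
theorem exists_limit_of_modular_cauchy (h : IsPhi O M) {w : ℕ → α → ℝ}
    (hw : ∀ k, MemE O M (w k)) {C : ℝ≥0}
    (hC : ∀ k j, k ≤ j → modular O M (2⁻¹ ^ k) (fun x => w k x - w j x) ≤ C * 2⁻¹ ^ k) :
    ∃ v, MemE O M v ∧ ∀ᵐ x ∂volume.restrict O, Tendsto (fun k => w k x) atTop (𝓝 (v x)) := by
  have hmeas : ∀ k, AEMeasurable (fun x => (M x (‖w k x - w (k + 1) x‖₊ / 2⁻¹ ^ k) : ℝ≥0∞))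
      (volume.restrict O) := fun k => h.aemeasurable_comp ((hw k).1.sub (hw (k + 1)).1) _
  have hsum : ∫⁻ x in O, ∑' k, (M x (‖w k x - w (k + 1) x‖₊ / 2⁻¹ ^ k) : ℝ≥0∞) ≠ ⊤ := by
    rw [lintegral_tsum hmeas]
    refine ne_top_of_le_ne_top ?_ (ENNReal.tsum_le_tsum fun k => hC k (k + 1) k.le_succ)
    rw [ENNReal.tsum_mul_left, ENNReal.tsum_geometric, ENNReal.one_sub_inv_two, inv_inv]
    exact ENNReal.mul_ne_top ENNReal.coe_ne_top ENNReal.ofNat_ne_top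
  have hae : ∀ᵐ x ∂volume.restrict O, ∃ y, Tendsto (fun k => w k x) atTop (𝓝 y) := by
    filter_upwards [ae_lt_top' (AEMeasurable.tsum hmeas) hsum, h.ae_pos, h.ae_monotone]
      with x h1 h2 h3
    have h4 := ENNReal.tendsto_atTop_zero_of_tsum_ne_top h1.ne
    have h5 : ∀ᶠ k in atTop, ‖w k x - w (k + 1) x‖₊ / 2⁻¹ ^ k ≤ 1 := by
      filter_upwards [h4.eventually (gt_mem_nhds (ENNReal.coe_pos.2 (h2 1 one_pos)))] with k hk
      by_contra hcon
      exact absurd (h3 (not_le.1 hcon).le) (not_le.2 (by exact_mod_cast hk))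
    have h6 : Summable fun k => dist (w k x) (w (k + 1) x) := by
      have hgeo : Summable fun k : ℕ => (2⁻¹ : ℝ) ^ k :=
        summable_geometric_of_lt_one (by norm_num) (by norm_num)
      refine Summable.of_norm_bounded_eventually_nat hgeo ?_
      filter_upwards [h5] with k hk
      rw [div_le_one (by positivity)] at hk
      rw [Real.norm_of_nonneg dist_nonneg, dist_eq_norm]
      exact_mod_cast hk
    exact cauchySeq_tendsto_of_complete (cauchySeq_of_summable_dist h6)
  obtain ⟨v, hvm, hv⟩ := measurable_limit_of_tendsto_metrizable_ae (fun k => (hw k).1) hae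
  refine ⟨v, ⟨hvm.aemeasurable, fun l hl => ?_⟩, hv⟩
  obtain ⟨k, hk⟩ := exists_pow_lt_of_lt_one (show (0 : ℝ≥0) < l / 2 by positivity)
    (show (2⁻¹ : ℝ≥0) < 1 from inv_lt_one_of_one_lt₀ one_lt_two)
  refine (h.modular_half (v := w k) (w := fun x => w k x - v x) (hw k).1
    (Eventually.of_forall fun x => ?_)).trans_lt ?_
  · simpa using nnnorm_sub_le (w k x) (w k x - v x)
  · refine ENNReal.add_lt_top.2 ⟨ENNReal.div_lt_top ((hw k).2 _ (by positivity)).ne two_ne_zero,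
      ENNReal.div_lt_top ?_ two_ne_zero⟩
    refine ne_top_of_le_ne_top ?_ ((h.modular_anti (by positivity) hk.le _).trans
      (modular_le_of_tendsto h (hw k).1 (fun j => (hw j).1) hv
        ((eventually_ge_atTop k).mono fun j hj => hC k j hj)))
    exact ENNReal.mul_ne_top ENNReal.coe_ne_top (ENNReal.pow_ne_top (by simp))

end Complete

/-! ### Time slices and Fubini -/

section Slices

variable {N : ℕ} {T : ℝ} {Ω : Set (EuclideanSpace ℝ (Fin N))}
  {M M' : ℝ × EuclideanSpace ℝ (Fin N) → ℝ≥0 → ℝ≥0}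

theorem volume_restrict_cylinder :
    (volume.restrict (cylinder T Ω) : Measure (ℝ × EuclideanSpace ℝ (Fin N))) =
      (volume.restrict (Ioo 0 T)).prod (volume.restrict Ω) := by
  rw [Measure.prod_restrict, ← Measure.volume_eq_prod]; rfl

theorem isOpen_cylinder (hΩ : IsOpen Ω) : IsOpen (cylinder T Ω) := isOpen_Ioo.prod hΩ

theorem ae_ae_of_ae_cylinder {p : ℝ × EuclideanSpace ℝ (Fin N) → Prop}
    (h : ∀ᵐ z ∂volume.restrict (cylinder T Ω), p z) :
    ∀ᵐ t ∂volume.restrict (Ioo 0 T), ∀ᵐ x ∂volume.restrict Ω, p (t, x) := by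
  rw [volume_restrict_cylinder] at h
  exact Measure.ae_ae_of_ae_prod h

theorem ae_aemeasurable_slice {β : Type*} [MeasurableSpace β]
    {u : ℝ × EuclideanSpace ℝ (Fin N) → β} (hu : AEMeasurable u (volume.restrict (cylinder T Ω))) :
    ∀ᵐ t ∂volume.restrict (Ioo 0 T), AEMeasurable (fun x => u (t, x)) (volume.restrict Ω) := by
  obtain ⟨v, hv, huv⟩ := hu
  filter_upwards [ae_ae_of_ae_cylinder huv] with t ht
  exact ⟨fun x => v (t, x), hv.comp measurable_prodMk_left, ht⟩

/-- The null set of times on which measurability fails depends on `s`; a dense sequence of values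
and continuity in `s` leave only countably many. -/
theorem IsPhi.ae_slice (h : IsPhi (cylinder T Ω) M) :
    ∀ᵐ t ∂volume.restrict (Ioo 0 T), IsPhi Ω fun x => M (t, x) := by
  obtain ⟨s, hs⟩ := TopologicalSpace.exists_dense_seq ℝ≥0
  filter_upwards [ae_all_iff.2 fun n => ae_aemeasurable_slice (h.aemeasurable (s n)),
    ae_ae_of_ae_cylinder h.ae_convexOn, ae_ae_of_ae_cylinder h.ae_zero,
    ae_ae_of_ae_cylinder h.ae_pos, ae_ae_of_ae_cylinder h.ae_tendsto,
    ae_ae_of_ae_cylinder h.ae_tendsto_div_zero, ae_ae_of_ae_cylinder h.ae_tendsto_div_atTop]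
    with t h1 h2 h3 h4 h5 h6 h7
  refine ⟨fun r => ?_, h2, h3, h4, h5, h6, h7⟩
  obtain ⟨y, hy, hyt⟩ := mem_closure_iff_seq_limit.1 (hs r)
  choose j hj using hy
  refine aemeasurable_of_tendsto_metrizable_ae atTop (fun n => h1 (j n)) ?_
  filter_upwards [h2, h3] with x hx hx0
  have := ((convex_continuous hx hx0).tendsto r).comp hyt
  simpa only [← hj, Function.comp_def] using this

theorem IsComplementaryPair.ae_slice (h : IsComplementaryPair (cylinder T Ω) M M') :
    ∀ᵐ t ∂volume.restrict (Ioo 0 T),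
      IsComplementaryPair Ω (fun x => M (t, x)) fun x => M' (t, x) := by
  filter_upwards [h.left.ae_slice, h.right.ae_slice, ae_ae_of_ae_cylinder h.ae_isLUB]
    with t h1 h2 h3 using ⟨h1, h2, h3⟩

/-- Fubini on products of exhausting compact sets with integer constants, which are countably many;
monotonicity gives the other constants. -/
theorem IsLocInt.ae_slice (hΩ : IsOpen Ω) (h : IsPhi (cylinder T Ω) M)
    (hM : IsLocInt (cylinder T Ω) M) :
    ∀ᵐ t ∂volume.restrict (Ioo 0 T), IsLocInt Ω fun x => M (t, x) := by
  obtain ⟨I, hI, hIT, -, hIs⟩ := exists_compact_exhaustion (isOpen_Ioo (a := 0) (b := T))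
  obtain ⟨K, hK, hKΩ, -, hKs⟩ := exists_compact_exhaustion hΩ
  have key : ∀ j m n : ℕ, ∀ᵐ t ∂volume.restrict (Ioo 0 T), t ∈ I j →
      ∫⁻ x in K m, (M (t, x) (n + 1) : ℝ≥0∞) < ⊤ := by
    intro j m n
    have hsub : I j ×ˢ K m ⊆ cylinder T Ω := prod_mono (hIT j) (hKΩ m)
    have h1 := hM (n + 1) (by positivity) _ ((hI j).prod (hK m)) hsub
    have hm : AEMeasurable (fun z => (M z (n + 1) : ℝ≥0∞))
        ((volume.restrict (I j)).prod (volume.restrict (K m))) := by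
      rw [Measure.prod_restrict, ← Measure.volume_eq_prod]
      exact ((h.aemeasurable (n + 1)).mono_set hsub).coe_nnreal_ennreal
    rw [Measure.volume_eq_prod, ← Measure.prod_restrict, lintegral_prod _ hm] at h1
    have h2 := ae_lt_top' hm.lintegral_prod_right' h1.ne
    rw [ae_restrict_iff' (hI j).measurableSet] at h2
    exact ae_restrict_of_ae h2
  filter_upwards [ae_all_iff.2 fun j => ae_all_iff.2 fun m => ae_all_iff.2 fun n => key j m n,
    ae_restrict_mem measurableSet_Ioo, h.ae_slice] with t ht htT hφ c hc C hC hCΩ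
  obtain ⟨j, hj⟩ := hIs {t} isCompact_singleton (singleton_subset_iff.2 htT)
  obtain ⟨m, hm⟩ := hKs C hC hCΩ
  obtain ⟨n, hn⟩ := exists_nat_ge c
  refine lt_of_le_of_lt ?_ (ht j m n (hj rfl))
  refine (lintegral_mono_set hm).trans (lintegral_mono_ae ?_)
  filter_upwards [ae_restrict_of_ae_restrict_of_subset (hKΩ m) hφ.ae_monotone] with x hx
  have := hx (hn.trans (show (n : ℝ≥0) ≤ n + 1 by simp))
  exact_mod_cast this

theorem IsPhi.aemeasurable_modular_slice (h : IsPhi (cylinder T Ω) M)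
    {u : ℝ × EuclideanSpace ℝ (Fin N) → ℝ} (hu : AEMeasurable u (volume.restrict (cylinder T Ω)))
    (l : ℝ≥0) :
    AEMeasurable (fun t => modular Ω (fun x => M (t, x)) l fun x => u (t, x))
      (volume.restrict (Ioo 0 T)) := by
  have := h.aemeasurable_comp hu l
  rw [volume_restrict_cylinder] at this
  exact this.lintegral_prod_right'

theorem IsPhi.modular_cylinder (h : IsPhi (cylinder T Ω) M)
    {u : ℝ × EuclideanSpace ℝ (Fin N) → ℝ} (hu : AEMeasurable u (volume.restrict (cylinder T Ω)))
    (l : ℝ≥0) :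
    modular (cylinder T Ω) M l u =
      ∫⁻ t in Ioo 0 T, modular Ω (fun x => M (t, x)) l fun x => u (t, x) := by
  have := h.aemeasurable_comp hu l
  unfold modular
  rw [volume_restrict_cylinder] at this ⊢
  exact lintegral_prod _ this

theorem IsPhi.ae_modular_slice_lt_top (h : IsPhi (cylinder T Ω) M)
    {u : ℝ × EuclideanSpace ℝ (Fin N) → ℝ} (hu : AEMeasurable u (volume.restrict (cylinder T Ω)))
    {l : ℝ≥0} (hl : modular (cylinder T Ω) M l u < ⊤) :
    ∀ᵐ t ∂volume.restrict (Ioo 0 T), modular Ω (fun x => M (t, x)) l (fun x => u (t, x)) < ⊤ := by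
  rw [h.modular_cylinder hu] at hl
  exact ae_lt_top' (h.aemeasurable_modular_slice hu l) hl.ne

theorem IsPhi.ae_memL_slice (h : IsPhi (cylinder T Ω) M)
    {u : ℝ × EuclideanSpace ℝ (Fin N) → ℝ} (hu : MemL (cylinder T Ω) M u) :
    ∀ᵐ t ∂volume.restrict (Ioo 0 T), MemL Ω (fun x => M (t, x)) fun x => u (t, x) := by
  obtain ⟨h1, l, hl, h2⟩ := hu
  filter_upwards [ae_aemeasurable_slice h1, h.ae_modular_slice_lt_top h1 h2] with t h3 h4
  exact ⟨h3, l, hl, h4⟩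

theorem IsPhi.ae_memE_slice (h : IsPhi (cylinder T Ω) M)
    {u : ℝ × EuclideanSpace ℝ (Fin N) → ℝ} (hu : MemE (cylinder T Ω) M u) :
    ∀ᵐ t ∂volume.restrict (Ioo 0 T), MemE Ω (fun x => M (t, x)) fun x => u (t, x) := by
  filter_upwards [ae_aemeasurable_slice hu.1, h.ae_slice,
    ae_all_iff.2 fun n : ℕ => h.ae_modular_slice_lt_top hu.1 (hu.2 (1 / (n + 1)) (by positivity))]
    with t h3 h5 h4
  refine ⟨h3, fun l hl => ?_⟩
  obtain ⟨n, hn⟩ := exists_nat_one_div_lt (NNReal.coe_pos.2 hl)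
  exact (h5.modular_anti (by positivity) (by exact_mod_cast hn.le) _).trans_lt (h4 n)

/-- The restriction of a tuple of functions to the time `t`. -/
def slice {ι : Type*} (t : ℝ) (U : ι → ℝ × EuclideanSpace ℝ (Fin N) → ℝ) :
    ι → EuclideanSpace ℝ (Fin N) → ℝ := fun i x => U i (t, x)

theorem aestronglyMeasurable_integral_slice {f : ℝ × EuclideanSpace ℝ (Fin N) → ℝ}
    (hf : AEMeasurable f (volume.restrict (cylinder T Ω))) :
    AEStronglyMeasurable (fun t => ∫ x in Ω, f (t, x)) (volume.restrict (Ioo 0 T)) := by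
  rw [volume_restrict_cylinder] at hf
  exact hf.aestronglyMeasurable.integral_prod_right'

theorem integrable_integral_slice {f : ℝ × EuclideanSpace ℝ (Fin N) → ℝ}
    (hf : IntegrableOn f (cylinder T Ω)) : IntegrableOn (fun t => ∫ x in Ω, f (t, x)) (Ioo 0 T) := by
  rw [IntegrableOn, volume_restrict_cylinder] at hf
  exact hf.integral_prod_left

theorem pairing_cylinder {U w : Fin (N + 1) → ℝ × EuclideanSpace ℝ (Fin N) → ℝ}
    (h : ∀ i, IntegrableOn (fun z => U i z * w i z) (cylinder T Ω)) :
    pairing (cylinder T Ω) U w = ∫ t in Ioo 0 T, pairing Ω (slice t U) (slice t w) := by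
  unfold pairing slice
  rw [integral_finsetSum _ fun i _ => integrable_integral_slice (h i)]
  refine Finset.sum_congr rfl fun i _ => ?_
  have := h i
  rw [IntegrableOn, volume_restrict_cylinder] at this
  rw [volume_restrict_cylinder, integral_prod _ this]

theorem integrable_mul_of_locallyIntegrableOn {α : Type*} [TopologicalSpace α] [T2Space α]
    [MeasurableSpace α] [OpensMeasurableSpace α] [SecondCountableTopology α]
    {μ : Measure α} {O : Set α} {f g : α → ℝ}
    (hf : LocallyIntegrableOn f O μ) (hg : Continuous g) (hgc : HasCompactSupport g)
    (hgO : tsupport g ⊆ O) : Integrable (fun x => g x * f x) μ := by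
  rw [← integrableOn_iff_integrable_of_support_subset (s := tsupport g)]
  · exact (hf.integrableOn_compact_subset hgO hgc).continuousOn_mul hg.continuousOn hgc
  · exact (Function.support_mul_subset_left g f).trans (subset_tsupport g)

/-- The tensor product of a function of time and a function of space. -/
def tensor (η : ℝ → ℝ) (φ : EuclideanSpace ℝ (Fin N) → ℝ) (z : ℝ × EuclideanSpace ℝ (Fin N)) : ℝ :=
  η z.1 * φ z.2

theorem IsTest.tensor {η : ℝ → ℝ} {φ : EuclideanSpace ℝ (Fin N) → ℝ} (hη : IsTest (Ioo 0 T) η)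
    (hφ : IsTest Ω φ) : IsTest (cylinder T Ω) (tensor η φ) := by
  have hsub : tsupport (Musielak.tensor η φ) ⊆ tsupport η ×ˢ tsupport φ := by
    refine closure_minimal (fun z hz => ?_) ((isClosed_tsupport η).prod (isClosed_tsupport φ))
    exact ⟨subset_tsupport _ (left_ne_zero_of_mul hz), subset_tsupport _ (right_ne_zero_of_mul hz)⟩
  exact ⟨(hη.1.comp contDiff_fst).mul (hφ.1.comp contDiff_snd),
    (hη.2.1.isCompact.prod hφ.2.1.isCompact).of_isClosed_subset (isClosed_tsupport _) hsub,
    hsub.trans (prod_mono hη.2.2 hφ.2.2)⟩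

theorem slice_jet {φ : ℝ × EuclideanSpace ℝ (Fin N) → ℝ} (hφ : IsTest (cylinder T Ω) φ) (t : ℝ) :
    slice t (jet (spaceDir N) φ) = jet (dir N) fun x => φ (t, x) := by
  funext i
  refine Fin.cases rfl (fun i => ?_) i
  funext x
  have h1 : HasFDerivAt (fun x => φ (t, x)) ((fderiv ℝ φ (t, x)).comp
      (ContinuousLinearMap.inr ℝ ℝ (EuclideanSpace ℝ (Fin N)))) x :=
    (hφ.differentiable (t, x)).hasFDerivAt.comp x (hasFDerivAt_prodMk_right t x)
  simp only [slice, jet_succ]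
  rw [h1.fderiv]
  rfl

theorem jet_tensor {η : ℝ → ℝ} {φ : EuclideanSpace ℝ (Fin N) → ℝ} (hη : IsTest (Ioo 0 T) η)
    (hφ : IsTest Ω φ) (t : ℝ) :
    slice t (jet (spaceDir N) (tensor η φ)) = fun i x => η t * jet (dir N) φ i x := by
  rw [slice_jet (hη.tensor hφ), ← jet_const_mul hφ]
  rfl

theorem IsTest.slice {φ : ℝ × EuclideanSpace ℝ (Fin N) → ℝ} (hφ : IsTest (cylinder T Ω) φ) {t : ℝ} :
    IsTest Ω fun x => φ (t, x) := by
  have hsub : tsupport (fun x => φ (t, x)) ⊆ (fun x => (t, x)) ⁻¹' tsupport φ :=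
    closure_minimal (fun x hx => subset_tsupport φ hx)
      ((isClosed_tsupport φ).preimage (by fun_prop))
  refine ⟨hφ.1.comp (contDiff_const.prodMk contDiff_id), ?_, fun x hx => (hφ.2.2 (hsub hx)).2⟩
  refine (hφ.2.1.isCompact.image continuous_snd).of_isClosed_subset (isClosed_tsupport _) ?_
  exact fun x hx => ⟨(t, x), hsub hx, rfl⟩

/-- Tuples annihilating the test functions on the cylinder do so at almost every time. -/
theorem ae_pairing_slice_eq_zero (hΩ : IsOpen Ω)
    {W : Fin (N + 1) → ℝ × EuclideanSpace ℝ (Fin N) → ℝ}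
    (hW : ∀ i, LocallyIntegrableOn (W i) (cylinder T Ω))
    (hWs : ∀ᵐ t ∂volume.restrict (Ioo 0 T), ∀ i, LocallyIntegrableOn (slice t W i) Ω)
    (h : ∀ φ, IsTest (cylinder T Ω) φ → pairing (cylinder T Ω) (jet (spaceDir N) φ) W = 0) :
    ∀ᵐ t ∂volume.restrict (Ioo 0 T), ∀ φ, IsTest Ω φ →
      pairing Ω (jet (dir N) φ) (slice t W) = 0 := by
  obtain ⟨D, hD, hDs⟩ := exists_countable_test hΩ (dir N)
  suffices hn : ∀ n, ∀ᵐ t ∂volume.restrict (Ioo 0 T),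
      pairing Ω (jet (dir N) (D n)) (slice t W) = 0 by
    filter_upwards [ae_all_iff.2 hn, hWs] with t h1 h2
    exact hDs _ h2 h1
  intro n
  have hloc : ∀ i, LocallyIntegrableOn
      (fun t => ∫ x in Ω, jet (dir N) (D n) i x * slice t W i x) (Ioo 0 T) := by
    intro i
    rw [locallyIntegrableOn_iff isOpen_Ioo.isLocallyClosed]
    intro I hI hIc
    have h1 : IntegrableOn (fun z : ℝ × EuclideanSpace ℝ (Fin N) =>
        jet (dir N) (D n) i z.2 * W i z) (I ×ˢ tsupport (D n)) := by
      have hc : IsCompact (I ×ˢ tsupport (D n)) := hIc.prod (hD n).2.1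
      exact ((hW i).integrableOn_compact_subset (prod_mono hI (hD n).2.2) hc).continuousOn_mul
        (((hD n).continuous_jet _ i).comp continuous_snd).continuousOn hc
    have h2 : IntegrableOn (fun z : ℝ × EuclideanSpace ℝ (Fin N) =>
        jet (dir N) (D n) i z.2 * W i z) (I ×ˢ Ω) := by
      refine h1.of_forall_sdiff_eq_zero (hIc.measurableSet.prod hΩ.measurableSet) fun z hz => ?_
      rw [jet_eq_zero (fun hz2 => hz.2 ⟨hz.1.1, hz2⟩), zero_mul]
    rw [IntegrableOn, Measure.volume_eq_prod, ← Measure.prod_restrict] at h2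
    exact h2.integral_prod_left
  have hloc' : LocallyIntegrableOn (fun t => pairing Ω (jet (dir N) (D n)) (slice t W))
      (Ioo 0 T) := by
    rw [locallyIntegrableOn_iff isOpen_Ioo.isLocallyClosed]
    intro I hI hIc
    exact integrable_finsetSum _ fun i _ => (hloc i).integrableOn_compact_subset hI hIc
  rw [ae_restrict_iff' measurableSet_Ioo]
  -- With the spatial test function fixed, the pairing is locally integrable in time and is killed
  -- by every `η`, because the product with `η` is a test function on the cylinder.
  refine isOpen_Ioo.ae_eq_zero_of_integral_contDiff_smul_eq_zero hloc' fun η h1 h2 h3 => ?_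
  have hη : IsTest (Ioo 0 T) η := ⟨h1, h2, h3⟩
  have hΦ := hη.tensor (hD n)
  have h4 := h _ hΦ
  rw [pairing_cylinder fun i => (integrable_mul_of_locallyIntegrableOn (hW i)
    (hΦ.continuous_jet _ i) (hΦ.hasCompactSupport_jet _ i)
    ((tsupport_jet_subset _ _ i).trans hΦ.2.2)).integrableOn] at h4
  simp_rw [jet_tensor hη (hD n), pairing_const_mul_left] at h4
  rw [← h4, setIntegral_eq_integral_of_forall_compl_eq_zero]
  · rfl
  · intro t ht
    rw [image_eq_zero_of_notMem_tsupport fun h => ht (h3 h), zero_mul]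

end Slices

/-! ### From slices to the cylinder -/

theorem HasWeakDeriv.ae_eq {α : Type*} [NormedAddCommGroup α] [NormedSpace ℝ α]
    [FiniteDimensional ℝ α] [MeasureSpace α] [BorelSpace α] {O : Set α} (hO : IsOpen O) {e : α}
    {u g g' : α → ℝ} (h : HasWeakDeriv O e u g) (h' : HasWeakDeriv O e u g') :
    g =ᵐ[volume.restrict O] g' := by
  have key := hO.ae_eq_zero_of_integral_contDiff_smul_eq_zero (μ := (volume : Measure α))
    (h.2.1.sub h'.2.1) fun φ h1 h2 h3 => ?_
  · rw [EventuallyEq, ae_restrict_iff' hO.measurableSet]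
    filter_upwards [key] with x hx hxO
    exact sub_eq_zero.1 (hx hxO)
  · have hφ : IsTest O φ := ⟨h1, h2, h3⟩
    have h4 : Integrable fun x => φ x * g x :=
      integrable_mul_of_locallyIntegrableOn h.2.1 h1.continuous h2 h3
    have h5 : Integrable fun x => φ x * g' x :=
      integrable_mul_of_locallyIntegrableOn h'.2.1 h1.continuous h2 h3
    have hz : ∀ x ∉ O, φ x = 0 := fun x hx =>
      image_eq_zero_of_notMem_tsupport fun h => hx (h3 h)
    have h6 : ∫ x, φ x * g x = ∫ x, φ x * g' x := by
      rw [← setIntegral_eq_integral_of_forall_compl_eq_zero (s := O)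
          (fun x hx => by rw [hz x hx, zero_mul]),
        ← setIntegral_eq_integral_of_forall_compl_eq_zero (s := O) (f := fun x => φ x * g' x)
          (fun x hx => by rw [hz x hx, zero_mul])]
      simp only [mul_comm (φ _)]
      exact neg_injective ((h.2.2 φ hφ).symm.trans (h'.2.2 φ hφ))
    simp only [smul_eq_mul, Pi.sub_apply, mul_sub]
    rw [integral_sub h4 h5, h6, sub_self]

theorem locallyIntegrableOn_swapAt {α : Type*} [TopologicalSpace α] [MeasurableSpace α]
    {μ : Measure α} {O : Set α} {N : ℕ} {U : Fin (N + 1) → α → ℝ} {i : Fin N}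
    (h0 : LocallyIntegrableOn (U 0) O μ) (hi : LocallyIntegrableOn (U i.succ) O μ)
    (j : Fin (N + 1)) : LocallyIntegrableOn (swapAt i U j) O μ := by
  refine Fin.cases hi (fun j => ?_) j
  rcases eq_or_ne j i with rfl | hj
  · simpa [swapAt] using h0
  · have h : swapAt i U j.succ = fun _ => 0 := by simp [swapAt, hj]; rfl
    rw [h]
    exact locallyIntegrableOn_zero

section

variable {N : ℕ} {T : ℝ} {Ω : Set (EuclideanSpace ℝ (Fin N))}
  {M M' : ℝ × EuclideanSpace ℝ (Fin N) → ℝ≥0 → ℝ≥0}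

theorem slice_swapAt (t : ℝ) (i : Fin N) (U : Fin (N + 1) → ℝ × EuclideanSpace ℝ (Fin N) → ℝ) :
    slice t (swapAt i U) = swapAt i (slice t U) := by
  funext j
  refine Fin.cases rfl (fun j => ?_) j
  rcases eq_or_ne j i with rfl | hj
  · funext x; simp [slice, swapAt]
  · funext x; simp [slice, swapAt, hj]

theorem W1x0L_subset_closure (hΩ : IsOpen Ω) (h : IsComplementaryPair (cylinder T Ω) M M')
    (hM : IsLocInt (cylinder T Ω) M) (hM' : IsLocInt (cylinder T Ω) M') :
    W1x0L T Ω M M' ⊆ closure[weakStar (cylinder T Ω) M M' N]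
      (testFunctions (cylinder T Ω) M (spaceDir N)) := by
  rintro U ⟨hU, hUt⟩
  rw [mem_closure_testFunctions_iff h hM]
  intro w hw hφ
  have hO := isOpen_cylinder (T := T) hΩ
  have hUL : ∀ᵐ t ∂volume.restrict (Ioo 0 T), ∀ i, LocallyIntegrableOn (slice t U.1 i) Ω := by
    filter_upwards [h.ae_slice, hM'.ae_slice hΩ h.right,
      ae_all_iff.2 fun i => h.left.ae_memL_slice (U.2 i)] with t h1 h2 h3 i
    exact h1.locallyIntegrableOn_left hΩ h2 (h3 i)
  have hwE : ∀ᵐ t ∂volume.restrict (Ioo 0 T), ∀ i, MemE Ω (fun x => M' (t, x)) (slice t w i) :=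
    ae_all_iff.2 fun i => h.right.ae_memE_slice (hw i)
  have hwL : ∀ᵐ t ∂volume.restrict (Ioo 0 T), ∀ i, LocallyIntegrableOn (slice t w i) Ω := by
    filter_upwards [h.ae_slice, hM.ae_slice hΩ h.left, hwE] with t h1 h2 h3 i
    exact h1.locallyIntegrableOn_right hΩ h2 (h3 i)
  have hw0 := ae_pairing_slice_eq_zero hΩ (fun i => h.locallyIntegrableOn_right hO hM (hw i)) hwL hφ
  -- Slicing the annihilation property of `swapAt i U` turns `∇U` into the weak gradient of almost
  -- every slice.
  have hU0 := ae_all_iff.2 fun i : Fin N => ae_pairing_slice_eq_zero hΩ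
    (fun j => locallyIntegrableOn_swapAt (hU i).1 (hU i).2.1 j)
    (by
      filter_upwards [hUL] with t ht j
      rw [slice_swapAt]
      exact locallyIntegrableOn_swapAt (ht _) (ht _) j)
    ((hasWeakDeriv_iff (e := spaceDir N)).1 (hU i)).2.2
  rw [pairing_cylinder fun i => h.integrable_mul (U.2 i) (hw i)]
  refine integral_eq_zero_of_ae ?_
  filter_upwards [hUt, hUL, hwE, hw0, hU0, h.ae_slice, hM.ae_slice hΩ h.left]
    with t ⟨V, ⟨hV1, hV2⟩, hV0⟩ h1 h2 h3 h4 h5 h6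
  have hder : ∀ i : Fin N, HasWeakDeriv Ω (dir N i) (slice t U.1 0) (slice t U.1 i.succ) := by
    intro i
    rw [hasWeakDeriv_iff]
    refine ⟨h1 _, h1 _, fun φ hφ => ?_⟩
    rw [← slice_swapAt]
    exact h4 i φ hφ
  -- `V` is only given to share its entry `0` with the slice; uniqueness of weak derivatives matches
  -- the others.
  have hae : ∀ i, slice t U.1 i =ᵐ[volume.restrict Ω] V.1 i := by
    intro i
    refine Fin.cases ?_ (fun i => ?_) i
    · rw [hV0]; rfl
    · have := hV1 i
      rw [hV0] at this
      exact (hder i).ae_eq hΩ this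
  rw [pairing_congr hae]
  exact (mem_closure_testFunctions_iff h5 h6).1 hV2 _ h2 h3

end

/-! ### From the cylinder to slices: measurable solution of countable systems -/

section

variable {α : Type*} [MeasureSpace α] {O : Set α} {M M' : α → ℝ≥0 → ℝ≥0} {N : ℕ}

/-- Young's inequality at scale `1` for `f` and `b` for the difference: the error is of order `b`,
with a constant depending only on `f` and `N`. -/
theorem IsComplementaryPair.abs_pairing_sub_le (h : IsComplementaryPair O M M')
    {f v d : Fin (N + 1) → α → ℝ} (hf : ∀ i, AEMeasurable (f i) (volume.restrict O))
    (hf1 : ∀ i, modular O M 1 (f i) < ⊤) (hv : ∀ i, MemE O M' (v i)) (hd : ∀ i, MemE O M' (d i))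
    {b : ℝ≥0} (hb : 0 < b) (hvd : ∀ i, modular O M' b (fun x => v i x - d i x) ≤ 1) :
    |pairing O f v - pairing O f d| ≤ b * ((∑ i, (modular O M 1 (f i)).toReal) + (N + 1)) := by
  have hfL : ∀ i, MemL O M (f i) := fun i => ⟨hf i, 1, one_pos, hf1 i⟩
  have e1 : pairing O f v - pairing O f d = ∑ i, ∫ x in O, f i x * (v i x - d i x) := by
    unfold pairing
    rw [← Finset.sum_sub_distrib]
    refine Finset.sum_congr rfl fun i _ => ?_
    rw [← integral_sub (h.integrable_mul (hfL i) (hv i)) (h.integrable_mul (hfL i) (hd i))]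
    simp only [mul_sub]
  rw [e1]
  refine (Finset.abs_sum_le_sum_abs _ _).trans ?_
  have e2 : (b : ℝ) * ((∑ i, (modular O M 1 (f i)).toReal) + (N + 1)) =
      ∑ i : Fin (N + 1), b * ((modular O M 1 (f i)).toReal + 1) := by
    rw [← Finset.mul_sum, Finset.sum_add_distrib]
    simp
  rw [e2]
  refine Finset.sum_le_sum fun i _ => ?_
  have h1 := h.norm_integral_mul_le (v := fun x => v i x - d i x) (hf i) one_pos hb (hf1 i).ne
    (ne_top_of_le_ne_top ENNReal.one_ne_top (hvd i))
  refine h1.trans ?_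
  have h2 : (modular O M' b fun x => v i x - d i x).toReal ≤ 1 := by
    have := ENNReal.toReal_mono ENNReal.one_ne_top (hvd i)
    simpa using this
  rw [NNReal.coe_one, one_mul]
  gcongr

/-- Comparison through `v` costs one halving, hence the scale `2⁻¹ ^ (k + 1)`. The resulting Cauchy
condition no longer mentions `v` and can be imposed on indices alone. -/
theorem IsPhi.modular_sub_le_of_approx (h : IsPhi O M) {v : α → ℝ} {d : ℕ → α → ℝ}
    (hv : AEMeasurable v (volume.restrict O)) (hd : ∀ k, AEMeasurable (d k) (volume.restrict O))
    (hvd : ∀ k, modular O M (2⁻¹ ^ (k + 1)) (fun x => v x - d k x) ≤ 2⁻¹ ^ k) {k j : ℕ}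
    (hkj : k ≤ j) : modular O M (2⁻¹ ^ k) (fun x => d k x - d j x) ≤ 2⁻¹ ^ k := by
  have e : (2⁻¹ : ℝ≥0) ^ k / 2 = 2⁻¹ ^ (k + 1) := by rw [pow_succ, div_eq_mul_inv]
  have h1 := h.modular_half (l := 2⁻¹ ^ k) (u := fun x => d k x - d j x)
    (v := fun x => v x - d k x) (w := fun x => v x - d j x) (hv.sub (hd k))
    (Eventually.of_forall fun x => by
      have := nnnorm_sub_le (v x - d j x) (v x - d k x)
      rw [sub_sub_sub_cancel_left] at this
      rwa [add_comm])
  rw [e] at h1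
  have h2 : modular O M (2⁻¹ ^ (k + 1)) (fun x => v x - d j x) ≤ 2⁻¹ ^ k := by
    have hle : (2⁻¹ : ℝ≥0) ≤ 1 := inv_le_one_of_one_le₀ one_le_two
    refine (h.modular_anti (by positivity) (pow_le_pow_of_le_one (zero_le) hle
      (Nat.succ_le_succ hkj)) _).trans ((hvd j).trans ?_)
    exact pow_le_pow_of_le_one (zero_le) (by simp) hkj
  refine h1.trans ?_
  calc _ ≤ (2⁻¹ : ℝ≥0∞) ^ k / 2 + 2⁻¹ ^ k / 2 := by
        gcongr
        exact hvd k
    _ = 2⁻¹ ^ k := ENNReal.add_halves _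

end

/-- Tuples are enumerated by a surjection onto `ι → ℕ`. Finitely many of them share one bound and
one compact support, which is what a selection with bounded indices needs. -/
theorem exists_countable_dense_tuple {α : Type*} [NormedAddCommGroup α] [NormedSpace ℝ α]
    [FiniteDimensional ℝ α] [MeasureSpace α] [BorelSpace α] {O : Set α} (hO : IsOpen O)
    [IsFiniteMeasureOnCompacts (volume : Measure α)] (ι : Type*) [Finite ι] :
    ∃ d : ℕ → ι → α → ℝ, (∀ n i, Measurable (d n i)) ∧
      (∀ n, ∃ (c : ℝ≥0) (K : Set α), IsCompact K ∧ K ⊆ O ∧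
        ∀ b ≤ n, ∀ i x, ‖d b i x‖₊ ≤ c ∧ (x ∉ K → d b i x = 0)) ∧
      ∀ M : α → ℝ≥0 → ℝ≥0, IsPhi O M → IsLocInt O M → ∀ v : ι → α → ℝ, (∀ i, MemE O M (v i)) →
        ∀ l : ℝ≥0, 0 < l → ∀ ε : ℝ≥0∞, ε ≠ 0 →
          ∃ n, ∀ i, modular O M l (fun x => v i x - d n i x) < ε := by
  have := Fintype.ofFinite ι
  obtain ⟨d, hd, hdb, hdK, hdd⟩ := exists_countable_dense hO
  obtain ⟨s, hs⟩ := exists_surjective_nat (ι → ℕ)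
  choose c hc using hdb
  choose K hK hKO hdK using hdK
  refine ⟨fun n i => d (s n i), fun n i => hd _, fun n => ?_, fun M h hM v hv l hl ε hε => ?_⟩
  · let F : Finset ℕ := (Finset.range (n + 1) ×ˢ (Finset.univ : Finset ι)).image fun p => s p.1 p.2
    refine ⟨∑ m ∈ F, c m, ⋃ m ∈ F, K m, F.isCompact_biUnion fun m _ => hK m,
      iUnion₂_subset fun m _ => hKO m, fun b hb i x => ?_⟩
    have hF : s b i ∈ F := Finset.mem_image.2 ⟨(b, i), by simp; omega, rfl⟩
    exact ⟨(hc _ x).trans (Finset.single_le_sum (f := c) (fun _ _ => zero_le) hF),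
      fun hx => hdK _ x fun h => hx (mem_biUnion hF h)⟩
  · choose m hm using fun i => hdd M h hM (v i) (hv i) l hl ε hε
    obtain ⟨n, hn⟩ := hs m
    exact ⟨n, fun i => by simpa only [hn] using hm i⟩

section

variable {N : ℕ} {T : ℝ} {Ω : Set (EuclideanSpace ℝ (Fin N))}
  {M M' : ℝ × EuclideanSpace ℝ (Fin N) → ℝ≥0 → ℝ≥0}

theorem nullMeasurableSet_modular_slice_le (h : IsPhi (cylinder T Ω) M)
    {u : EuclideanSpace ℝ (Fin N) → ℝ} (hu : Measurable u) (l : ℝ≥0) (c : ℝ≥0∞) :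
    NullMeasurableSet {t | modular Ω (fun x => M (t, x)) l u ≤ c} (volume.restrict (Ioo 0 T)) :=
  nullMeasurableSet_le
    (h.aemeasurable_modular_slice (u := fun z => u z.2) (hu.comp measurable_snd).aemeasurable l)
    aemeasurable_const

theorem nullMeasurableSet_abs_pairing_le (h : IsPhi (cylinder T Ω) M)
    {f : Fin (N + 1) → ℝ × EuclideanSpace ℝ (Fin N) → ℝ}
    (hf : ∀ i, AEMeasurable (f i) (volume.restrict (cylinder T Ω)))
    {d : Fin (N + 1) → EuclideanSpace ℝ (Fin N) → ℝ} (hd : ∀ i, Measurable (d i)) (a b c : ℝ) :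
    NullMeasurableSet {t | |a - pairing Ω (slice t f) d| ≤
      b * ((∑ i, (modular Ω (fun x => M (t, x)) 1 (slice t f i)).toReal) + c)}
      (volume.restrict (Ioo 0 T)) := by
  refine nullMeasurableSet_le ?_ ?_
  · have h1 : AEMeasurable (fun t => pairing Ω (slice t f) d) (volume.restrict (Ioo 0 T)) :=
      Finset.aemeasurable_fun_sum _ fun i _ => (aestronglyMeasurable_integral_slice
        (f := fun z => f i z * d i z.2)
        ((hf i).mul ((hd i).comp measurable_snd).aemeasurable)).aemeasurable
    simp only [← Real.norm_eq_abs]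
    exact (aemeasurable_const.sub h1).norm
  · refine ((Finset.aemeasurable_fun_sum _ fun i _ => ?_).add_const _).const_mul _
    exact (h.aemeasurable_modular_slice (hf i) 1).ennreal_toReal

/-- If on a set of times of positive outer measure a countable system of linear equations is
solvable in `Π E_{M'(t)}`, then a single element of `Π E_{M'}` on the cylinder solves the system
at all times of a set of positive measure, and solves the homogeneous system at other times. -/
theorem exists_measurable_solution (hΩ : IsOpen Ω) (h : IsComplementaryPair (cylinder T Ω) M M')
    (hM' : IsLocInt (cylinder T Ω) M')
    {f : ℕ → Fin (N + 1) → ℝ × EuclideanSpace ℝ (Fin N) → ℝ}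
    (hf : ∀ n i, AEMeasurable (f n i) (volume.restrict (cylinder T Ω)))
    (hf1 : ∀ n, ∀ᵐ t ∂volume.restrict (Ioo 0 T), ∀ i,
      modular Ω (fun x => M (t, x)) 1 (slice t (f n) i) < ⊤) (a : ℕ → ℝ) {B : Set ℝ}
    (hB : ∀ t ∈ B, ∃ v : Fin (N + 1) → EuclideanSpace ℝ (Fin N) → ℝ,
      (∀ i, MemE Ω (fun x => M' (t, x)) (v i)) ∧ ∀ n, pairing Ω (slice t (f n)) v = a n)
    (hB0 : volume.restrict (Ioo 0 T) B ≠ 0) :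
    ∃ (S : Set ℝ) (w : Fin (N + 1) → ℝ × EuclideanSpace ℝ (Fin N) → ℝ), MeasurableSet S ∧
      0 < volume.restrict (Ioo 0 T) S ∧ (∀ i, MemE (cylinder T Ω) M' (w i)) ∧
      ∀ᵐ t ∂volume.restrict (Ioo 0 T), ∀ n,
        pairing Ω (slice t (f n)) (slice t w) = S.indicator (fun _ => a n) t := by
  obtain ⟨d, hd, hdK, hdd⟩ := exists_countable_dense_tuple hΩ (Fin (N + 1))
  have hgood : ∀ᵐ t ∂volume.restrict (Ioo 0 T),
      IsComplementaryPair Ω (fun x => M (t, x)) (fun x => M' (t, x)) ∧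
      IsLocInt Ω (fun x => M' (t, x)) ∧
      (∀ n i, AEMeasurable (slice t (f n) i) (volume.restrict Ω)) ∧
      ∀ n i, modular Ω (fun x => M (t, x)) 1 (slice t (f n) i) < ⊤ := by
    filter_upwards [h.ae_slice, hM'.ae_slice hΩ h.right,
      ae_all_iff.2 fun n => ae_all_iff.2 fun i => ae_aemeasurable_slice (hf n i),
      ae_all_iff.2 hf1] with t h1 h2 h3 h4 using ⟨h1, h2, h3, h4⟩
  have hdE : ∀ t, IsPhi Ω (fun x => M' (t, x)) → IsLocInt Ω (fun x => M' (t, x)) →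
      ∀ b i, MemE Ω (fun x => M' (t, x)) (d b i) := by
    intro t h1 h2 b i
    obtain ⟨c, K, hK, hKΩ, hcK⟩ := hdK b
    exact h1.memE_of_bounded h2 (hd b i).aemeasurable (fun x => (hcK b le_rfl i x).1) hK hKΩ
      fun x hx => (hcK b le_rfl i x).2 hx
  -- `R` says that `d b` solves every equation up to order `2⁻ᵏ`, and `Q` is the modular Cauchy
  -- condition. A branch of `P` is an index sequence satisfying both; the default of `getD` is never
  -- read.
  let R : ℕ → ℕ → Set ℝ := fun k b => {t | ∀ n, |a n - pairing Ω (slice t (f n)) (d b)| ≤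
    ((2⁻¹ ^ k : ℝ≥0) : ℝ) *
      ((∑ i, (modular Ω (fun x => M (t, x)) 1 (slice t (f n) i)).toReal) + (N + 1))}
  let Q : ℕ → ℕ → ℕ → Set ℝ := fun k b c => {t | ∀ i,
    modular Ω (fun x => M' (t, x)) (2⁻¹ ^ k) (fun x => d b i x - d c i x) ≤ 2⁻¹ ^ k}
  let P : List ℕ → Set ℝ := fun l => (⋂ k ∈ {k | k < l.length}, R k (l.getD k 0)) ∩
    ⋂ k ∈ {k | k < l.length}, ⋂ j ∈ {j | j < l.length ∧ k ≤ j}, Q k (l.getD k 0) (l.getD j 0)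
  have hP : ∀ l, NullMeasurableSet (P l) (volume.restrict (Ioo 0 T)) := by
    intro l
    refine (NullMeasurableSet.biInter (to_countable _) fun k _ => ?_).inter
      (NullMeasurableSet.biInter (to_countable _) fun k _ =>
        NullMeasurableSet.biInter (to_countable _) fun j _ => ?_)
    · simp only [R, ofPred_forall]
      exact NullMeasurableSet.iInter fun n =>
        nullMeasurableSet_abs_pairing_le h.left (hf n) (fun i => hd _ i) _ _ _
    · simp only [Q, ofPred_forall]
      exact NullMeasurableSet.iInter fun i =>
        nullMeasurableSet_modular_slice_le h.right ((hd _ i).sub (hd _ i)) _ _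
  have hPmem : ∀ t (σ : ℕ → ℕ), (∀ m, t ∈ P ((List.range m).map σ)) ↔
      (∀ k, t ∈ R k (σ k)) ∧ ∀ k j, k ≤ j → t ∈ Q k (σ k) (σ j) := by
    intro t σ
    have hget : ∀ m k, k < m → ((List.range m).map σ).getD k 0 = σ k := by
      intro m k hk
      simp [List.getD, hk]
    simp only [P, mem_inter_iff, mem_iInter, mem_ofPred_eq, List.length_map, List.length_range]
    constructor
    · intro hm
      refine ⟨fun k => ?_, fun k j hkj => ?_⟩
      · have := (hm (k + 1)).1 k k.lt_succ_self
        rwa [hget _ _ k.lt_succ_self] at this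
      · have := (hm (j + 1)).2 k (Nat.lt_succ_of_le hkj) j ⟨j.lt_succ_self, hkj⟩
        rwa [hget _ _ (Nat.lt_succ_of_le hkj), hget _ _ j.lt_succ_self] at this
    · rintro ⟨h1, h2⟩ m
      refine ⟨fun k hk => ?_, fun k hk j hj => ?_⟩
      · rw [hget m k hk]; exact h1 k
      · rw [hget m k hk, hget m j hj.1]; exact h2 k j hj.2
  -- every time in `B` outside a null set has a branch
  have hpow1 : ∀ k, (2⁻¹ : ℝ≥0∞) ^ k ≤ 1 := fun k => pow_le_one₀ (zero_le) (by simp)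
  obtain ⟨n, S, σ, hS, hS0, hσ, hσS⟩ := exists_selection hP (B := B ∩ {t |
      IsComplementaryPair Ω (fun x => M (t, x)) (fun x => M' (t, x)) ∧
      IsLocInt Ω (fun x => M' (t, x)) ∧
      (∀ n i, AEMeasurable (slice t (f n) i) (volume.restrict Ω)) ∧
      ∀ n i, modular Ω (fun x => M (t, x)) 1 (slice t (f n) i) < ⊤}) (by
    rintro t ⟨htB, h1, h2, h3, h4⟩
    obtain ⟨v, hv, hva⟩ := hB t htB
    choose σ hσ using fun k : ℕ => hdd _ h1.right h2 v hv (2⁻¹ ^ (k + 1)) (by positivity)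
      (2⁻¹ ^ k) (pow_ne_zero _ (by simp))
    refine ⟨σ, (hPmem t σ).2 ⟨fun k m => ?_, fun k j hkj i => ?_⟩⟩
    · rw [← hva m]
      refine h1.abs_pairing_sub_le (h3 m) (h4 m) hv (hdE t h1.right h2 _) (by positivity)
        fun i => ?_
      have hle : (2⁻¹ : ℝ≥0) ≤ 1 := inv_le_one_of_one_le₀ one_le_two
      exact ((h1.right.modular_anti (by positivity)
        (pow_le_pow_of_le_one (zero_le) hle k.le_succ) _).trans (hσ k i).le).trans (hpow1 k)
    · exact h1.right.modular_sub_le_of_approx (d := fun k => d (σ k) i) (hv i).1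
        (fun k => (hd _ i).aemeasurable) (fun k => (hσ k i).le) hkj) (by
    rw [pos_iff_ne_zero]
    intro h0
    refine hB0 (le_antisymm ?_ (zero_le))
    refine (measure_mono_ae ?_).trans h0.le
    filter_upwards [hgood] with t ht htB using ⟨htB, ht⟩)
  replace hσS : ∀ t ∈ S, (∀ k, σ k t ≤ n k) ∧ (∀ k, t ∈ R k (σ k t)) ∧
      ∀ k j, k ≤ j → t ∈ Q k (σ k t) (σ j t) := fun t ht =>
    ⟨fun k => (hσS t ht k).1, (hPmem t fun i => σ i t).1 fun m => (hσS t ht m).2⟩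
  -- restriction to a compact set of times
  obtain ⟨I, hI, hIT, -, hIs⟩ := exists_compact_exhaustion (isOpen_Ioo (a := 0) (b := T))
  obtain ⟨j, hj⟩ : ∃ j, 0 < volume.restrict (Ioo 0 T) (S ∩ I j) := by
    by_contra hcon
    push Not at hcon
    have h0 : volume.restrict (Ioo 0 T) (⋃ j, S ∩ I j) = 0 :=
      measure_iUnion_null fun j => le_antisymm (hcon j) (zero_le)
    refine hS0.ne' (le_antisymm ((measure_mono_ae ?_).trans h0.le) (zero_le))
    filter_upwards [ae_restrict_mem measurableSet_Ioo] with t ht htS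
    obtain ⟨j, hj⟩ := hIs {t} isCompact_singleton (singleton_subset_iff.2 ht)
    exact mem_iUnion.2 ⟨j, htS, hj rfl⟩
  have hSj : MeasurableSet (S ∩ I j) := hS.inter (hI j).measurableSet
  let W : ℕ → Fin (N + 1) → ℝ × EuclideanSpace ℝ (Fin N) → ℝ := fun k i =>
    ((S ∩ I j) ×ˢ univ).indicator fun z => d (σ k z.1) i z.2
  have hWin : ∀ k i t x, t ∈ S ∩ I j → W k i (t, x) = d (σ k t) i x := fun k i t x ht =>
    indicator_of_mem (mk_mem_prod ht (mem_univ x)) _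
  have hWout : ∀ k i t x, t ∉ S ∩ I j → W k i (t, x) = 0 := fun k i t x ht =>
    indicator_of_notMem (fun h : (t, x) ∈ (S ∩ I j) ×ˢ univ => ht h.1) _
  have hWm : ∀ k i, Measurable (W k i) := by
    intro k i
    refine Measurable.indicator ?_ (hSj.prod MeasurableSet.univ)
    have h1 : Measurable fun p : ℕ × EuclideanSpace ℝ (Fin N) => d p.1 i p.2 :=
      measurable_from_prod_countable_right fun b => hd b i
    exact h1.comp (((hσ k).comp measurable_fst).prodMk measurable_snd)
  -- On the selected times the index is at most `n k`, so `W k i` uses finitely many `d b`: it is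
  -- bounded, with support in the compact set `I j ×ˢ K`.
  have hWE : ∀ i k, MemE (cylinder T Ω) M' (W k i) := by
    intro i k
    obtain ⟨c, K, hK, hKΩ, hcK⟩ := hdK (n k)
    refine h.right.memE_of_bounded hM' (hWm k i).aemeasurable (c := c) (fun z => ?_)
      ((hI j).prod hK) (prod_mono (hIT j) hKΩ) fun z hz => ?_
    · by_cases hzS : z.1 ∈ S ∩ I j
      · rw [show W k i z = _ from hWin k i z.1 z.2 hzS]
        exact (hcK _ ((hσS _ hzS.1).1 k) i _).1
      · rw [show W k i z = _ from hWout k i z.1 z.2 hzS]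
        simp
    · by_cases hzS : z.1 ∈ S ∩ I j
      · rw [show W k i z = _ from hWin k i z.1 z.2 hzS]
        exact (hcK _ ((hσS _ hzS.1).1 k) i _).2 fun hzK => hz ⟨hzS.2, hzK⟩
      · exact hWout k i z.1 z.2 hzS
  have hWC : ∀ i k m, k ≤ m → modular (cylinder T Ω) M' (2⁻¹ ^ k) (fun z => W k i z - W m i z) ≤
      T.toNNReal * 2⁻¹ ^ k := by
    intro i k m hkm
    rw [h.right.modular_cylinder (u := fun z => W k i z - W m i z)
      ((hWm k i).sub (hWm m i)).aemeasurable]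
    calc _ ≤ ∫⁻ _ in Ioo 0 T, (2⁻¹ : ℝ≥0∞) ^ k := by
          refine lintegral_mono_ae ?_
          filter_upwards [hgood] with t ht
          by_cases htS : t ∈ S ∩ I j
          · simp only [hWin _ _ _ _ htS]
            exact (hσS t htS.1).2.2 k m hkm i
          · simp only [hWout _ _ _ _ htS, sub_zero, ht.1.right.modular_zero]
            exact zero_le
      _ = T.toNNReal * 2⁻¹ ^ k := by
          rw [setLIntegral_const, Real.volume_Ioo, sub_zero, mul_comm]; rfl
  choose w hwE hw using fun i => exists_limit_of_modular_cauchy h.right (hWE i) (hWC i)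
  refine ⟨S ∩ I j, w, hSj, hj, hwE, ?_⟩
  filter_upwards [hgood, ae_all_iff.2 fun i => ae_ae_of_ae_cylinder (hw i),
    ae_all_iff.2 fun i => h.right.ae_memE_slice (hwE i)] with t ⟨h1, h2, h3, h4⟩ hwt hwEt m
  by_cases ht : t ∈ S ∩ I j
  · rw [indicator_of_mem ht]
    simp only [hWin _ _ _ _ ht] at hwt
    obtain ⟨-, hR, hQ⟩ := hσS t ht.1
    set C : ℝ := (∑ i, (modular Ω (fun x => M (t, x)) 1 (slice t (f m) i)).toReal) + (N + 1)
    -- One term `2⁻ᵏ C` is the residual from `R`; the other is the distance to the limit, obtained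
    -- from `Q` by Fatou.
    have hbound : ∀ k, |pairing Ω (slice t (f m)) (slice t w) - a m| ≤ (2⁻¹ : ℝ) ^ k * (2 * C) := by
      intro k
      have h5 := hR k m
      have h6 := h1.abs_pairing_sub_le (v := d (σ k t)) (d := slice t w) (b := 2⁻¹ ^ k) (h3 m) (h4 m)
        (hdE t h1.right h2 _) hwEt (by positivity) fun i =>
          (modular_le_of_tendsto h1.right (hd _ i).aemeasurable (fun q => (hd _ i).aemeasurable)
            (hwt i) ((eventually_ge_atTop k).mono fun q hq => hQ k q hq i)).trans (hpow1 k)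
      push_cast at h5 h6
      rw [abs_sub_comm]
      calc _ = |(a m - pairing Ω (slice t (f m)) (d (σ k t))) +
            (pairing Ω (slice t (f m)) (d (σ k t)) - pairing Ω (slice t (f m)) (slice t w))| := by
              rw [sub_add_sub_cancel]
        _ ≤ (2⁻¹ : ℝ) ^ k * C + (2⁻¹ : ℝ) ^ k * C := (abs_add_le _ _).trans (add_le_add h5 h6)
        _ = _ := by ring
    have hlim : Tendsto (fun k : ℕ => (2⁻¹ : ℝ) ^ k * (2 * C)) atTop (𝓝 0) := by
      simpa using (tendsto_pow_atTop_nhds_zero_of_lt_one (r := (2⁻¹ : ℝ)) (by norm_num)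
        (by norm_num)).mul_const (2 * C)
    have := ge_of_tendsto' hlim hbound
    exact sub_eq_zero.1 (abs_eq_zero.1 (le_antisymm this (abs_nonneg _)))
  · rw [indicator_of_notMem ht]
    have h0 : ∀ i, slice t w i =ᵐ[volume.restrict Ω] fun _ => 0 := by
      intro i
      filter_upwards [hwt i] with x hx
      simp only [hWout _ _ _ _ ht] at hx
      exact (tendsto_nhds_unique hx tendsto_const_nhds)
    rw [pairing_congr_right (z := fun _ _ => 0) h0]
    simp [pairing]

theorem closure_subset_W1x0L (hΩ : IsOpen Ω) (h : IsComplementaryPair (cylinder T Ω) M M')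
    (hM : IsLocInt (cylinder T Ω) M) (hM' : IsLocInt (cylinder T Ω) M') :
    closure[weakStar (cylinder T Ω) M M' N]
      (testFunctions (cylinder T Ω) M (spaceDir N)) ⊆ W1x0L T Ω M M' := by
  intro U hU
  have : (volume : Measure (ℝ × EuclideanSpace ℝ (Fin N))).IsAddHaarMeasure := by
    rw [Measure.volume_eq_prod]
    infer_instance
  refine ⟨closure_testFunctions_subset_sobolev h (isOpen_cylinder hΩ) hM hM' hU, ?_⟩
  rw [mem_closure_testFunctions_iff h hM] at hU
  -- The bad times, at which some annihilator detects `U(t)`. No measurability is known, so the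
  -- argument concerns its outer measure.
  let B : Set ℝ := {t | IsPhi Ω (fun x => M' (t, x)) ∧
    ∃ v : Fin (N + 1) → EuclideanSpace ℝ (Fin N) → ℝ,
    (∀ i, MemE Ω (fun x => M' (t, x)) (v i)) ∧
    (∀ φ, IsTest Ω φ → pairing Ω (jet (dir N) φ) v = 0) ∧ pairing Ω (slice t U.1) v ≠ 0}
  suffices hB : volume.restrict (Ioo 0 T) B = 0 by
    filter_upwards [measure_eq_zero_iff_ae_notMem.1 hB, h.ae_slice, hM.ae_slice hΩ h.left,
      hM'.ae_slice hΩ h.right, ae_all_iff.2 fun i => h.left.ae_memL_slice (U.2 i)]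
      with t ht h1 h2 h3 h4
    have hcl : (⟨slice t U.1, h4⟩ : ProdL Ω (fun x => M (t, x)) N) ∈
        closure[weakStar Ω (fun x => M (t, x)) (fun x => M' (t, x)) N]
          (testFunctions Ω (fun x => M (t, x)) (dir N)) := by
      refine (mem_closure_testFunctions_iff h1 h2).2 fun v hv hφ => ?_
      by_contra hne
      exact ht ⟨h1.right, v, hv, hφ, hne⟩
    exact ⟨_, ⟨closure_testFunctions_subset_sobolev h1 hΩ h2 h3 hcl, hcl⟩, rfl⟩
  by_contra hB
  obtain ⟨D, hD, hDs⟩ := exists_countable_test hΩ (dir N)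
  choose hUm l hl hUl using U.2
  -- `r` dominates every scale `l i`, so all entries of `U / r` have finite modular at scale `1`.
  let r : ℝ≥0 := ∑ i, l i
  have hlr : ∀ i, l i ≤ r := fun i =>
    Finset.single_le_sum (f := l) (fun _ _ => zero_le) (Finset.mem_univ i)
  have hr : 0 < r := (hl 0).trans_le (hlr 0)
  have hr0 : (r : ℝ) ≠ 0 := by exact_mod_cast hr.ne'
  -- Equation `0` normalises the pairing with `U / r` to `1`; equation `n + 1` demands that the jet
  -- of `D n` be annihilated.
  let f : ℕ → Fin (N + 1) → ℝ × EuclideanSpace ℝ (Fin N) → ℝ := fun n =>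
    Nat.casesOn n (fun i z => (r : ℝ)⁻¹ * U.1 i z) fun n i z => jet (dir N) (D n) i z.2
  let a : ℕ → ℝ := fun n => Nat.casesOn n 1 fun _ => 0
  have hf0 : ∀ t, slice t (f 0) = fun i x => (r : ℝ)⁻¹ * slice t U.1 i x := fun _ => rfl
  have hf1 : ∀ t n, slice t (f (n + 1)) = jet (dir N) (D n) := fun _ _ => rfl
  obtain ⟨S, w, hS, hS0, hwE, hw⟩ := exists_measurable_solution hΩ h hM' (f := f) (a := a) (B := B)
    (by
      rintro (_ | n) i
      · exact (hUm i).const_mul _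
      · exact (((hD n).continuous_jet _ i).comp continuous_snd).aemeasurable)
    (by
      rintro (_ | n)
      · filter_upwards [h.left.ae_slice,
          ae_all_iff.2 fun i => h.left.ae_modular_slice_lt_top (hUm i) (hUl i)] with t h1 h2 i
        refine (h1.modular_mono (k := l i) (Eventually.of_forall fun x => ?_)).trans_lt (h2 i)
        rw [hf0, nnnorm_mul, nnnorm_inv, div_one, mul_comm, ← div_eq_mul_inv]
        have : ‖(r : ℝ)‖₊ = r := NNReal.nnnorm_eq r
        rw [this]
        have := hl i
        have := hlr i
        simp only [slice]
        gcongr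
      · filter_upwards [h.left.ae_slice, hM.ae_slice hΩ h.left] with t h1 h2 i
        exact ((hD n).memE_jet h1 h2 (dir N) i).2 1 one_pos)
    (by
      rintro t ⟨h1, v, hv, hφ, hne⟩
      refine ⟨fun i x => (r / pairing Ω (slice t U.1) v) * v i x, ?_, ?_⟩
      · exact fun i => h1.memE_const_mul (hv i) _
      · rintro (_ | n)
        · rw [hf0, pairing_const_mul_left, pairing_const_mul_right]
          change _ = (1 : ℝ)
          field_simp
        · rw [hf1, pairing_const_mul_right, hφ _ (hD n), mul_zero]) hB
  have hwt : ∀ᵐ t ∂volume.restrict (Ioo 0 T), ∀ φ, IsTest Ω φ →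
      pairing Ω (jet (dir N) φ) (slice t w) = 0 := by
    filter_upwards [hw, h.ae_slice, hM.ae_slice hΩ h.left,
      ae_all_iff.2 fun i => h.right.ae_memE_slice (hwE i)] with t h1 h2 h3 h4
    refine hDs _ (fun i => h2.locallyIntegrableOn_right hΩ h3 (h4 i)) fun n => ?_
    have := h1 (n + 1)
    rw [hf1] at this
    rw [this]
    change S.indicator (fun _ => (0 : ℝ)) t = 0
    simp
  have hzero := hU w hwE fun φ hφ => by
    rw [pairing_cylinder fun i => h.integrable_mul (hφ.memE_jet h.left hM _ i).memL (hwE i)]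
    refine integral_eq_zero_of_ae ?_
    filter_upwards [hwt] with t ht
    rw [slice_jet hφ]
    exact ht _ hφ.slice
  rw [pairing_cylinder fun i => h.integrable_mul (U.2 i) (hwE i)] at hzero
  -- The pairing of `U` with `w` is `r` times the measure of `S`, which is positive, although `w`
  -- annihilates the test functions.
  have hval : ∫ t in Ioo 0 T, pairing Ω (slice t U.1) (slice t w) =
      ∫ t in Ioo 0 T, S.indicator (fun _ => (r : ℝ)) t := by
    refine integral_congr_ae ?_
    filter_upwards [hw] with t ht
    have := ht 0
    rw [hf0, pairing_const_mul_left] at this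
    have h2 : pairing Ω (slice t U.1) (slice t w) = r * S.indicator (fun _ => (1 : ℝ)) t := by
      rw [← mul_inv_cancel_left₀ hr0 (pairing Ω (slice t U.1) (slice t w)), this]
      rfl
    rw [h2]
    by_cases htS : t ∈ S <;> simp [htS]
  rw [hval, integral_indicator hS, setIntegral_const, smul_eq_mul, mul_eq_zero] at hzero
  rcases hzero with h0 | h0
  · have : (volume.restrict (Ioo 0 T) S).toReal = 0 := h0
    rw [ENNReal.toReal_eq_zero_iff] at this
    exact this.elim hS0.ne' (measure_ne_top _ _)
  · exact hr0 h0

end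

end Musielak

theorem mainTheorem5 {N : ℕ} {T : ℝ} (hT : 0 < T)
    (Ω : Set (EuclideanSpace ℝ (Fin N))) (hΩ : IsOpen Ω)
    (M M' : ℝ × EuclideanSpace ℝ (Fin N) → ℝ≥0 → ℝ≥0)
    (hpair : Musielak.IsComplementaryPair (Musielak.cylinder T Ω) M M')
    (hM : Musielak.IsLocInt (Musielak.cylinder T Ω) M)
    (hM' : Musielak.IsLocInt (Musielak.cylinder T Ω) M') :
    Musielak.W1x0L T Ω M M' =
      closure[Musielak.weakStar (Musielak.cylinder T Ω) M M' N]
        (Musielak.testFunctions (Musielak.cylinder T Ω) M (Musielak.spaceDir N)) :=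
  (Musielak.W1x0L_subset_closure hΩ hpair hM hM').antisymm
    (Musielak.closure_subset_W1x0L hΩ hpair hM hM')
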